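/- Let $\mathbb F_q$ be a finite field. Let $\Gamma\subset\mathbb Z_{\ge 0}^r$ be a finitely generated subsemigroup containing $0$, equipped with a well-order $\prec$ such that $\alpha\prec\beta$ implies $\alpha+\gamma\prec\beta+\gamma$. An \emph{order domain with value semigroup $\Gamma$} is a commutative $\mathbb F_q$-algebra $R$ with a surjective map $\rho:R\to\{-\infty\}\cup\Gamma$ such that for all $f,g\in R$: (1) $\rho(f)=-\infty$ if and only if $f=0$; (2) $\rho(cf)=\rho(f)$ for $0\ne c\in\mathbb F_q$; (3) $\rho(f+g)\preceq\max\{\rho(f),\rho(g)\}$; (4) if $\rho(f)=\rho(g)\neq-\infty$, then $\rho(f-cg)\prec\rho(f)$ for some $0\ne c\in\mathbb F_q$; (5) $\rho(fg)=\rho(f)+\rho(g)$. Let $R_\Gamma=\mathbb F_q[\Gamma]\subset\mathbb F_q[T_1,\dots,T_r]$ be the subalgebra generated by the monomials $T^\gamma$, $\gamma\in\Gamma$. We say that $R$ \emph{has a flat deformation to} $R_\Gamma$ if there is a finitely generated commutative $\mathbb F_q[t]$-algebra $A$, flat over $\mathbb F_q[t]$, with $A/tA\cong R_\Gamma$ as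 $\mathbb F_q$-algebras and $\mathbb F_q[t,t^{-1}]\otimes_{\mathbb F_q[t]}A\cong \mathbb F_q[t,t^{-1}]\otimes_{\mathbb F_q}R$ as $\mathbb F_q[t,t^{-1}]$-algebras. For generators $\gamma_1,\dots,\gamma_s$ of $\Gamma$ let $M$ be the matrix with columns $\gamma_1,\dots,\gamma_s$, call $M\alpha=\sum_i\alpha_i\gamma_i\in\Gamma$ the weight of $X^\alpha$, and let $I_\Gamma\subset\mathbb F_q[X_1,\dots,X_s]$ be the ideal generated by all $X^\alpha-X^\beta$ with $M\alpha=M\beta$. For a monomial order $\tau$ let $>_{M,\tau}$ be the monomial order that compares first the weights by $\prec$ and breaks ties by $\tau$. An ideal $I\subset\mathbb F_q[X_1,\dots,X_s]$ is of \emph{Geil--Pellikaan form} for $(M,\tau)$ if every element of its reduced Gröbner basis for $>_{M,\tau}$ has exactly two monomials of highest weight in its support, and the standard monomials (those which are not leading monomials of nonzero elements of $I$) have distinct weights. \textbf{Theorem.} (a) Every order domain $R$ with value semigroup $\Gamma$ has a flat deformation to $R_\Gamma$. Moreover, for all generators $\gamma_1,\dots,\gamma_s$ of $\Gamma$ one has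 $\mathbb F_q[X_1,\dots,X_s]/I_\Gamma\cong R_\Gamma$ via $X_i\mapsto T^{\gamma_i}$, and for every $\tau$ there is an ideal $I$ of Geil--Pellikaan form for $(M,\tau)$ with $R\cong\mathbb F_q[X_1,\dots,X_s]/I$. (b) Conversely, for all generators $\gamma_1,\dots,\gamma_s$ of $\Gamma$ and every $\tau$, if $I$ is of Geil--Pellikaan form for $(M,\tau)$, then $\mathbb F_q[X_1,\dots,X_s]/I$ is an order domain with value semigroup $\Gamma$, with order function $\rho$ given as follows: if $f$ is a linear combination of standard monomials, then $\rho(f)$ is the maximal weight of a monomial in the support of $f$ (and $-\infty$ if $f=0$). -/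

import Mathlib

open scoped TensorProduct LaurentPolynomial

noncomputable section

/-- A well-ordered commutative semigroup (with zero): the total order is strictly compatible with
addition and every nonempty subset has a least element. -/
structure IsWellOrderedSemigroup (S : Type*) [AddCommMonoid S] [LinearOrder S] : Prop where
  add_lt_add : ∀ a b c : S, a < b → a + c < b + c
  wf : WellFounded (fun a b : S => a < b)

/-- `ρ : R → {-∞} ∪ S` is an order function on the `F`-algebra `R` with value semigroup `S`. -/
structure IsOrderFunction (F : Type*) [Field F] {R : Type*} [CommRing R] [Algebra F R]
    {S : Type*} [AddCommMonoid S] [LinearOrder S] (ρ : R → WithBot S) : Prop where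
  surjective : Function.Surjective ρ
  eq_bot_iff : ∀ f : R, ρ f = ⊥ ↔ f = 0
  smul : ∀ (c : F) (f : R), c ≠ 0 → ρ (c • f) = ρ f
  add_le : ∀ f g : R, ρ (f + g) ≤ max (ρ f) (ρ g)
  exists_sub_lt : ∀ f g : R, ρ f = ρ g → ρ f ≠ ⊥ → ∃ c : F, c ≠ 0 ∧ ρ (f - c • g) < ρ f
  mul : ∀ f g : R, ρ (f * g) = ρ f + ρ g

/-- The monomial `T^γ` in `F[T₁, …, T_r]`. -/
def toricMonomial (F : Type*) [Field F] {r : ℕ} (γ : Fin r → ℕ) : MvPolynomial (Fin r) F :=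
  ∏ i, MvPolynomial.X i ^ γ i

/-- The toric algebra `R_Γ = F[Γ]`: the subring of `F[T₁, …, T_r]` generated over `F` by the
monomials `T^γ` with `γ ∈ Γ`. -/
def toricAlgebra (F : Type*) [Field F] {r : ℕ} (Γ : AddSubmonoid (Fin r → ℕ)) :
    Subalgebra F (MvPolynomial (Fin r) F) :=
  Algebra.adjoin F (toricMonomial F '' (Γ : Set (Fin r → ℕ)))

/-- The weight of the monomial `X^α` for the weights `γ₁, …, γ_s`: the element
`α₁ γ₁ + ⋯ + α_s γ_s`. It is `M α` if `M` is the matrix with columns `γ₁, …, γ_s`. -/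
def monWeight {S : Type*} [AddCommMonoid S] {s : ℕ} (γ : Fin s → S) : (Fin s →₀ ℕ) →+ S :=
  Finsupp.weight γ

/-- The toric ideal: generated by the binomials `X^α - X^β` with `M α = M β`. -/
def toricIdeal (F : Type*) [Field F] {S : Type*} [AddCommMonoid S] {s : ℕ} (γ : Fin s → S) :
    Ideal (MvPolynomial (Fin s) F) :=
  Ideal.span {p | ∃ α β : Fin s →₀ ℕ, monWeight γ α = monWeight γ β ∧
    p = MvPolynomial.monomial α 1 - MvPolynomial.monomial β 1}

/-- `Spec A → Spec F[t]` is a flat family whose fibre over `t = 0` is `R₀` and whose restriction to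
the punctured line `t ≠ 0` is the constant family with fibre `R`. -/
structure IsFlatDeformation (F : Type*) [Field F] (A : Type*) [CommRing A]
    [Algebra (Polynomial F) A] [Algebra F A] (R : Type*) [CommRing R] [Algebra F R]
    (R₀ : Type*) [CommRing R₀] [Algebra F R₀] : Prop where
  flat : Module.Flat (Polynomial F) A
  special : Nonempty
    ((A ⧸ Ideal.span {algebraMap (Polynomial F) A Polynomial.X}) ≃ₐ[F] R₀)
  general : Nonempty (F[T;T⁻¹] ⊗[Polynomial F] A ≃ₐ[F[T;T⁻¹]] F[T;T⁻¹] ⊗[F] R)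

/-- `R` has a flat deformation to `R₀`, through a family of affine schemes
`A = F[t][X₁, …, X_n] / J` of finite type over the affine line. -/
def HasFlatDeformation (F : Type*) [Field F] (R : Type*) [CommRing R] [Algebra F R]
    (R₀ : Type*) [CommRing R₀] [Algebra F R₀] : Prop :=
  ∃ (n : ℕ) (J : Ideal (MvPolynomial (Fin n) (Polynomial F))),
    IsFlatDeformation F (MvPolynomial (Fin n) (Polynomial F) ⧸ J) R R₀

theorem IsWellOrderedSemigroup.zero_le {S : Type*} [AddCommMonoid S] [LinearOrder S]
    (hS : IsWellOrderedSemigroup S) (a : S) : 0 ≤ a := by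
  by_contra h
  rw [not_le] at h
  have hmin : ∀ x : S, x + a < x := fun x => by
    have := hS.add_lt_add a 0 x h
    rwa [zero_add, add_comm] at this
  exact hS.wf.induction (C := fun _ => False) a fun x ih => ih (x + a) (hmin x)

/-- The exponents, as a type of its own that carries the order of `weightOrder`. -/
structure WeightSyn (s : ℕ) where
  /-- the underlying exponent -/
  val : Fin s →₀ ℕ

/-- `WeightSyn s` is a copy of the exponents. -/
def WeightSyn.equiv (s : ℕ) : WeightSyn s ≃ (Fin s →₀ ℕ) where
  toFun := WeightSyn.val
  invFun := WeightSyn.mk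
  left_inv _ := rfl
  right_inv _ := rfl

instance (s : ℕ) : AddCommMonoid (WeightSyn s) := (WeightSyn.equiv s).addCommMonoid

/-- The pair (weight, tie-breaker) by which exponents are compared lexicographically. -/
def weightKey {S : Type*} [AddCommMonoid S] {s : ℕ} (γ : Fin s → S)
    (τ : MonomialOrder (Fin s)) (a : WeightSyn s) : S ×ₗ τ.syn :=
  toLex (monWeight γ a.val, τ.toSyn a.val)

theorem weightKey_injective {S : Type*} [AddCommMonoid S] {s : ℕ} (γ : Fin s → S)
    (τ : MonomialOrder (Fin s)) : Function.Injective (weightKey γ τ) := by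
  rintro ⟨a⟩ ⟨b⟩ h
  have h2 : τ.toSyn a = τ.toSyn b := congrArg (fun p => (ofLex p).2) h
  rw [τ.toSyn.injective h2]

/-- The monomial order `>_{M,τ}`: first compare the weights `M α`, then break ties by `τ`. -/
def weightOrder {S : Type*} [AddCommMonoid S] [LinearOrder S] (hS : IsWellOrderedSemigroup S)
    {s : ℕ} (γ : Fin s → S) (τ : MonomialOrder (Fin s)) : MonomialOrder (Fin s) :=
  letI : LinearOrder (WeightSyn s) := LinearOrder.lift' (weightKey γ τ) (weightKey_injective γ τ)
  have hlt : ∀ a b : WeightSyn s, a < b ↔ monWeight γ a.val < monWeight γ b.val ∨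
      monWeight γ a.val = monWeight γ b.val ∧ τ.toSyn a.val < τ.toSyn b.val := fun a b =>
    Prod.Lex.lt_iff (x := weightKey γ τ a) (y := weightKey γ τ b)
  have hadd : ∀ a b c : WeightSyn s, a < b → c + a < c + b := by
    intro a b c h
    have e : ∀ x : WeightSyn s, (c + x).val = c.val + x.val := fun _ => rfl
    rw [hlt] at h ⊢
    simp only [e, map_add]
    rcases h with h | ⟨h, h'⟩
    · left
      have := hS.add_lt_add _ _ (monWeight γ c.val) h
      rwa [add_comm, add_comm (monWeight γ b.val)] at this
    · right
      exact ⟨by rw [h], by gcongr⟩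
  { syn := WeightSyn s
    isOrderedAddMonoid_syn :=
      { add_le_add_left := fun a b h c => by
          rcases h.eq_or_lt with rfl | h
          · exact le_rfl
          · rw [add_comm a, add_comm b]
            exact (hadd a b c h).le }
    toSyn := { (WeightSyn.equiv s).symm with map_add' := fun _ _ => rfl }
    toSyn_monotone := by
      intro a b h
      obtain ⟨c, rfl⟩ := le_iff_exists_add.mp h
      rcases eq_or_ne c 0 with rfl | hc
      · simp
      · refine ((hlt ⟨a⟩ ⟨a + c⟩).mpr ?_).le
        simp only [map_add]
        rcases (hS.zero_le (monWeight γ c)).eq_or_lt with h0 | h0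
        · right
          refine ⟨by rw [← h0, add_zero], ?_⟩
          have : (0 : τ.syn) < τ.toSyn c :=
            (MonomialOrder.toSyn_lt_iff_ne_zero τ).mpr (by simpa using hc)
          exact lt_add_of_pos_right _ this
        · left
          have := hS.add_lt_add _ _ (monWeight γ a) h0
          rwa [zero_add, add_comm] at this
    wellFoundedLT_syn := by
      have : WellFoundedLT S := ⟨hS.wf⟩
      exact ⟨InvImage.wf (weightKey γ τ) (wellFounded_lt (α := S ×ₗ τ.syn))⟩ }

theorem weightOrder_lt_iff {S : Type*} [AddCommMonoid S] [LinearOrder S]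
    (hS : IsWellOrderedSemigroup S) {s : ℕ} (γ : Fin s → S) (τ : MonomialOrder (Fin s))
    (α β : Fin s →₀ ℕ) :
    (weightOrder hS γ τ).toSyn α < (weightOrder hS γ τ).toSyn β ↔
      monWeight γ α < monWeight γ β ∨
        monWeight γ α = monWeight γ β ∧ τ.toSyn α < τ.toSyn β :=
  Prod.Lex.lt_iff (x := weightKey γ τ ⟨α⟩) (y := weightKey γ τ ⟨β⟩)

/-- The exponents of the standard monomials of `I` (the footprint): those monomials which are not
the leading monomial of a nonzero element of `I`. -/
def standardMonomials {F : Type*} [Field F] {s : ℕ} (m : MonomialOrder (Fin s))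
    (I : Ideal (MvPolynomial (Fin s) F)) : Set (Fin s →₀ ℕ) :=
  {α | ¬ ∃ f ∈ I, f ≠ 0 ∧ m.degree f = α}

/-- `G` is the reduced Gröbner basis of `I` with respect to the monomial order `m`. -/
structure IsReducedGroebnerBasis {F : Type*} [Field F] {s : ℕ} (m : MonomialOrder (Fin s))
    (I : Ideal (MvPolynomial (Fin s) F)) (G : Finset (MvPolynomial (Fin s) F)) : Prop where
  mem : ∀ g ∈ G, g ∈ I
  /-- the leading monomial of every nonzero element of `I` is divisible by one of `G` -/
  exists_degree_le : ∀ f ∈ I, f ≠ 0 → ∃ g ∈ G, m.degree g ≤ m.degree f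
  monic : ∀ g ∈ G, m.leadingCoeff g = 1
  reduced : ∀ g ∈ G, ∀ h ∈ G, h ≠ g → ∀ α ∈ g.support, ¬ m.degree h ≤ α

/-- The Gröbner basis form: for the order `>_{M,τ}`, every element of the reduced Gröbner basis of
`I` has exactly two monomials of highest weight in its support, and the standard monomials of `I`
have distinct weights. -/
def IsGeilPellikaanForm {F : Type*} [Field F] {S : Type*} [AddCommMonoid S] [LinearOrder S]
    (hS : IsWellOrderedSemigroup S) {s : ℕ} (γ : Fin s → S) (τ : MonomialOrder (Fin s))
    (I : Ideal (MvPolynomial (Fin s) F)) : Prop :=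
  (∃ G : Finset (MvPolynomial (Fin s) F),
    IsReducedGroebnerBasis (weightOrder hS γ τ) I G ∧
    ∀ g ∈ G, {α | α ∈ g.support ∧ ∀ β ∈ g.support, monWeight γ β ≤ monWeight γ α}.ncard = 2) ∧
  Set.InjOn (monWeight γ) (standardMonomials (weightOrder hS γ τ) I)

/-- `ρ` is given on `F[X₁, …, X_s] / I` by the maximal weight in the standard form: if `f` is a
linear combination of standard monomials, then `ρ(f) = max {M β : X^β ∈ supp f}`. -/
def IsMaxWeight {F : Type*} [Field F] {S : Type*} [AddCommMonoid S] [LinearOrder S]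
    (hS : IsWellOrderedSemigroup S) {s : ℕ} (γ : Fin s → S) (τ : MonomialOrder (Fin s))
    (I : Ideal (MvPolynomial (Fin s) F)) (ρ : MvPolynomial (Fin s) F ⧸ I → WithBot S) : Prop :=
  ∀ f : MvPolynomial (Fin s) F,
    (∀ α ∈ f.support, α ∈ standardMonomials (weightOrder hS γ τ) I) →
      ρ (Ideal.Quotient.mk I f) = f.support.sup (fun β => (monWeight γ β : WithBot S))

end

/-! Both directions compare `ρ` with the weight of monomials. Choose `x_i` in `R` with `ρ (x_i) =
γ_i`; then `ρ` of a monomial in the `x_i` is its weight, and subtracting multiples of monomials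
writes every `r` as a polynomial with weights at most `ρ r` (`exists_aeval_eq`). Two monomials of
equal weight therefore satisfy a relation modulo smaller weights, so the standard monomials of the
kernel have distinct weights and each element of its reduced Gröbner basis has exactly two top
monomials (`isGeilPellikaanForm_ker`).

Conversely, a Gröbner basis element with a binomial top rewrites a nonstandard monomial as a nonzero
multiple of a smaller monomial of the same weight, modulo smaller weights. Hence every monomial has
a standard monomial of its own weight as top, with nonzero coefficient. Distinctness of weights
extends this to all polynomials outside `I`, and the weight of the top is the order function; it is
multiplicative because nonzero coefficients stay nonzero (`exists_isOrderFunction`).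

The flat deformation is a Rees algebra, which needs a filtration indexed by `ℕ` with associated
graded ring `F[Γ]`. Two adjustments provide it. The ratios of leading coefficients of monomials of
equal weight are multiplicative, hence come from a character of `ℤ^s`, and rescaling the `x_i` makes
them all `1` (`exists_normalized`). By Gordan's alternative some additive `l : Γ → ℕ` preserves the
finitely many strict inequalities between weights visible in the Gröbner basis
(`exists_addMonoidHom_nat_forall_lt`). Then each monomial equals the chosen one of its weight up to
terms of smaller `l`-weight (`exists_natWeight`). The `F[t]`-algebra generated by the `t^{l(γ_i)}
x_i` in `R[t, t⁻¹]` is torsion-free, hence flat; it becomes `R[t, t⁻¹]` when `t` is inverted, and at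
`t = 0` only the binomials of `I_Γ` survive. -/

theorem IsWellOrderedSemigroup.isOrderedCancelAddMonoid {S : Type*} [AddCommMonoid S]
    [LinearOrder S] (hS : IsWellOrderedSemigroup S) : IsOrderedCancelAddMonoid S where
  add_le_add_left a b h c := by
    rcases h.eq_or_lt with rfl | h
    · exact le_rfl
    · exact (hS.add_lt_add a b c h).le
  le_of_add_le_add_left a b c h := by
    by_contra h'
    have := hS.add_lt_add c b a (not_le.mp h')
    rw [add_comm c, add_comm b] at this
    exact absurd h (not_le.mpr this)

theorem monWeight_surjective {S : Type*} [AddCommMonoid S] {s : ℕ} {γ : Fin s → S}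
    (hγ : AddSubmonoid.closure (Set.range γ) = ⊤) : Function.Surjective (monWeight γ) := by
  rw [← AddMonoidHom.mrange_eq_top, eq_top_iff, ← hγ, AddSubmonoid.closure_le]
  rintro _ ⟨i, rfl⟩
  exact ⟨Finsupp.single i 1, by simp [monWeight, Finsupp.weight_single]⟩

/-- The polynomials all of whose monomials have weight less than `w`. -/
noncomputable def weightLT (F : Type*) [Field F] {S : Type*} [AddCommMonoid S] [LinearOrder S]
    {s : ℕ} (γ : Fin s → S) (w : S) : Submodule F (MvPolynomial (Fin s) F) :=
  MvPolynomial.restrictSupport F {β | monWeight γ β < w}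

theorem mem_weightLT {F : Type*} [Field F] {S : Type*} [AddCommMonoid S] [LinearOrder S] {s : ℕ}
    {γ : Fin s → S} {w : S} {f : MvPolynomial (Fin s) F} :
    f ∈ weightLT F γ w ↔ ∀ β ∈ f.support, monWeight γ β < w := by
  rw [weightLT, MvPolynomial.mem_restrictSupport_iff]; rfl

/-! ### Order functions evaluated on monomials -/

namespace IsOrderFunction

variable {F : Type*} [Field F] {R : Type*} [CommRing R] [Algebra F R]
  {S : Type*} [AddCommMonoid S] [LinearOrder S] {ρ : R → WithBot S}

theorem map_zero (h : IsOrderFunction F ρ) : ρ 0 = ⊥ := (h.eq_bot_iff 0).mpr rfl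

/-- The elements of order less than `w`. -/
def ltSubmodule (h : IsOrderFunction F ρ) (w : S) : Submodule F R where
  carrier := {f | ρ f < w}
  zero_mem' := by
    simp [h.map_zero]
  add_mem' {a b} ha hb := (h.add_le a b).trans_lt (max_lt ha hb)
  smul_mem' c f hf := by
    rcases eq_or_ne c 0 with rfl | hc
    · simp [h.map_zero]
    · simpa [h.smul c f hc] using hf

theorem mem_ltSubmodule (h : IsOrderFunction F ρ) {w : S} {f : R} :
    f ∈ h.ltSubmodule w ↔ ρ f < w := Iff.rfl

/-- The value is idempotent because `1 * 1 = 1`, and cancellation leaves only `0`; surjectivity of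
`ρ` excludes the zero ring. -/
theorem map_one (hS : IsWellOrderedSemigroup S) (h : IsOrderFunction F ρ) : ρ 1 = 0 := by
  have := hS.isOrderedCancelAddMonoid
  have h1 : ρ 1 ≠ ⊥ := by
    rw [Ne, h.eq_bot_iff]
    intro h10
    obtain ⟨f, hf⟩ := h.surjective ((0 : S) : WithBot S)
    have : f = 0 := by rw [← mul_one f, h10, mul_zero]
    rw [this, h.map_zero] at hf
    exact WithBot.bot_ne_coe hf
  obtain ⟨a, ha⟩ := WithBot.ne_bot_iff_exists.mp h1
  have h2 := h.mul 1 1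
  rw [mul_one, ← ha, ← WithBot.coe_add, WithBot.coe_inj] at h2
  rw [← ha, left_eq_add.mp h2]
  rfl

theorem map_pow (hS : IsWellOrderedSemigroup S) (h : IsOrderFunction F ρ) {f : R} {a : S}
    (hf : ρ f = a) (n : ℕ) : ρ (f ^ n) = (n • a : S) := by
  induction n with
  | zero => simp [h.map_one hS]
  | succ n ih => rw [pow_succ, h.mul, ih, hf, succ_nsmul]; rfl

variable {s : ℕ} {γ : Fin s → S} {x : Fin s → R}

theorem map_aeval_monomial (hS : IsWellOrderedSemigroup S) (h : IsOrderFunction F ρ)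
    (hx : ∀ i, ρ (x i) = γ i) (α : Fin s →₀ ℕ) :
    ρ (MvPolynomial.aeval x (MvPolynomial.monomial α (1 : F))) = monWeight γ α := by
  induction α using Finsupp.induction_linear with
  | zero => simp [h.map_one hS]
  | add a b ha hb =>
    have : MvPolynomial.monomial (a + b) (1 : F) =
      MvPolynomial.monomial a 1 * MvPolynomial.monomial b 1 := by simp [MvPolynomial.monomial_mul]
    rw [this, _root_.map_mul, h.mul, ha, hb, map_add]; rfl
  | single i n =>
    simp only [MvPolynomial.aeval_monomial, _root_.map_one, one_mul]
    rw [Finsupp.prod_single_index (by simp), h.map_pow hS (hx i)]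
    simp [monWeight, Finsupp.weight_single]

theorem aeval_mem_ltSubmodule (hS : IsWellOrderedSemigroup S) (h : IsOrderFunction F ρ)
    (hx : ∀ i, ρ (x i) = γ i) {w : S} {f : MvPolynomial (Fin s) F} (hf : f ∈ weightLT F γ w) :
    MvPolynomial.aeval x f ∈ h.ltSubmodule w := by
  rw [mem_weightLT] at hf
  rw [f.as_sum, map_sum]
  refine Submodule.sum_mem _ fun α hα => ?_
  have : MvPolynomial.monomial α (f.coeff α) = f.coeff α • MvPolynomial.monomial α (1 : F) := by
    simp [MvPolynomial.smul_monomial]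
  rw [this, map_smul]
  refine Submodule.smul_mem _ _ ?_
  rw [mem_ltSubmodule, h.map_aeval_monomial hS hx]
  exact WithBot.coe_lt_coe.mpr (hf α hα)

/-- Subduction: some monomial has the order of `r`, and subtracting a suitable multiple of it lowers
the order, so well-founded recursion terminates. The bound on the weights is what later turns an
inequality for `ρ` into one for leading monomials. -/
theorem exists_aeval_eq (hS : IsWellOrderedSemigroup S) (h : IsOrderFunction F ρ)
    (hγ : AddSubmonoid.closure (Set.range γ) = ⊤) (hx : ∀ i, ρ (x i) = γ i) (r : R) :
    ∃ f : MvPolynomial (Fin s) F, MvPolynomial.aeval x f = r ∧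
      ∀ β ∈ f.support, (monWeight γ β : WithBot S) ≤ ρ r := by
  classical
  have : WellFoundedLT S := ⟨hS.wf⟩
  induction hv : ρ r using WellFoundedLT.induction generalizing r with
  | _ v ih =>
  rcases eq_or_ne v ⊥ with rfl | hv0
  · rw [h.eq_bot_iff] at hv
    exact ⟨0, by simp [hv], by simp⟩
  · obtain ⟨w, rfl⟩ := WithBot.ne_bot_iff_exists.mp hv0
    obtain ⟨α, rfl⟩ := monWeight_surjective hγ w
    obtain ⟨c, -, hc⟩ := h.exists_sub_lt r (MvPolynomial.aeval x (MvPolynomial.monomial α (1 : F)))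
      (by rw [hv, h.map_aeval_monomial hS hx]) (by rw [hv]; exact hv0)
    rw [hv] at hc
    obtain ⟨f, hf, hf'⟩ := ih _ hc _ rfl
    refine ⟨f + MvPolynomial.monomial α c, ?_, ?_⟩
    · have : MvPolynomial.monomial α c = c • MvPolynomial.monomial α (1 : F) := by
        simp [MvPolynomial.smul_monomial]
      rw [map_add, hf, this, map_smul, sub_add_cancel]
    · intro β hβ
      rcases Finset.mem_union.mp (MvPolynomial.support_add hβ) with hβ | hβ
      · exact (hf' β hβ).trans hc.le
      · rw [Finset.mem_singleton.mp (MvPolynomial.support_monomial_subset hβ)]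

theorem exists_mem_weightLT_aeval_eq (hS : IsWellOrderedSemigroup S) (h : IsOrderFunction F ρ)
    (hγ : AddSubmonoid.closure (Set.range γ) = ⊤) (hx : ∀ i, ρ (x i) = γ i) {r : R} {w : S}
    (hr : ρ r < w) : ∃ f ∈ weightLT F γ w, MvPolynomial.aeval x f = r := by
  obtain ⟨f, hf, hf'⟩ := h.exists_aeval_eq hS hγ hx r
  exact ⟨f, mem_weightLT.mpr fun β hβ => WithBot.coe_lt_coe.mp ((hf' β hβ).trans_lt hr), hf⟩

end IsOrderFunction

/-! ### Normal forms modulo an ideal -/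

section NormalForm

variable {F : Type*} [Field F] {s : ℕ}

theorem not_mem_standardMonomials_of_le {m : MonomialOrder (Fin s)}
    {I : Ideal (MvPolynomial (Fin s) F)} {f : MvPolynomial (Fin s) F} (hf : f ∈ I) (hf0 : f ≠ 0)
    {α : Fin s →₀ ℕ} (h : m.degree f ≤ α) : α ∉ standardMonomials m I := by
  intro hα
  refine hα ⟨MvPolynomial.monomial (α - m.degree f) 1 * f, I.mul_mem_left _ hf, ?_, ?_⟩
  · exact mul_ne_zero (by simp) hf0
  · classical
    rw [m.degree_mul (by simp) hf0, m.degree_monomial, if_neg one_ne_zero, tsub_add_cancel_of_le h]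

/-- Every polynomial is congruent to a combination of standard monomials that do not exceed its
leading monomial. -/
theorem exists_normalForm (m : MonomialOrder (Fin s)) (I : Ideal (MvPolynomial (Fin s) F))
    (f : MvPolynomial (Fin s) F) :
    ∃ r : MvPolynomial (Fin s) F, f - r ∈ I ∧ (∀ α ∈ r.support, α ∈ standardMonomials m I) ∧
      ∀ α ∈ r.support, m.toSyn α ≤ m.toSyn (m.degree f) := by
  -- Dividing by all nonzero elements of `I`, rather than by a Gröbner basis, makes the remainder
  -- standard at once.
  obtain ⟨g, r, hfr, hg, hr⟩ := m.div_set (B := {b | b ∈ I ∧ b ≠ 0})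
    (fun b hb => by simpa using hb.2) f
  have hI : f - r ∈ I := by
    rw [hfr, add_sub_cancel_right, Finsupp.linearCombination_apply]
    exact I.sum_mem fun b _ => I.mul_mem_left _ b.2.1
  refine ⟨r, hI, ?_, ?_⟩
  · rintro α hα ⟨b, hb, hb0, rfl⟩
    exact hr _ hα b ⟨hb, hb0⟩ le_rfl
  · have h1 : m.toSyn (m.degree (f - r)) ≤ m.toSyn (m.degree f) := by
      rw [hfr, add_sub_cancel_right, ← hfr, Finsupp.linearCombination_apply, Finsupp.sum]
      refine m.degree_sum_le.trans (Finset.sup_le fun b _ => ?_)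
      simpa [mul_comm] using hg b
    intro α hα
    have h2 : m.toSyn (m.degree r) ≤ m.toSyn (m.degree f) := by
      have : r = f - (f - r) := by ring
      rw [this]
      exact m.degree_sub_le.trans (sup_le le_rfl h1)
    exact (m.le_degree hα).trans h2

end NormalForm

/-! ### Weights and the weight order -/

section WeightOrder

variable {F : Type*} [Field F] {S : Type*} [AddCommMonoid S] [LinearOrder S]
  {s : ℕ} {γ : Fin s → S}

theorem MonomialOrder.degree_eq_of_forall_le {m : MonomialOrder (Fin s)}
    {f : MvPolynomial (Fin s) F} {α : Fin s →₀ ℕ} (hα : f.coeff α ≠ 0)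
    (h : ∀ β ∈ f.support, m.toSyn β ≤ m.toSyn α) : m.degree f = α := by
  have hα' := MvPolynomial.mem_support_iff.mpr hα
  have hf : f ≠ 0 := by rintro rfl; simp at hα
  exact m.toSyn.injective (le_antisymm (h _ ((m.degree_mem_support_iff f).mpr hf)) (m.le_degree hα'))

theorem monWeight_le_of_weightOrder_le (hS : IsWellOrderedSemigroup S) {τ : MonomialOrder (Fin s)}
    {α β : Fin s →₀ ℕ}
    (h : (weightOrder hS γ τ).toSyn α ≤ (weightOrder hS γ τ).toSyn β) :
    monWeight γ α ≤ monWeight γ β := by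
  rcases h.eq_or_lt with h | h
  · rw [(weightOrder hS γ τ).toSyn.injective h]
  · rcases (weightOrder_lt_iff hS γ τ α β).mp h with h | h
    exacts [h.le, h.1.le]

theorem weightOrder_lt_of_monWeight_lt (hS : IsWellOrderedSemigroup S) {τ : MonomialOrder (Fin s)}
    {α β : Fin s →₀ ℕ} (h : monWeight γ α < monWeight γ β) :
    (weightOrder hS γ τ).toSyn α < (weightOrder hS γ τ).toSyn β :=
  (weightOrder_lt_iff hS γ τ α β).mpr (.inl h)

theorem coeff_eq_zero_of_mem_weightLT {f : MvPolynomial (Fin s) F} {w : S}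
    (hf : f ∈ weightLT F γ w) {α : Fin s →₀ ℕ} (hα : w ≤ monWeight γ α) : f.coeff α = 0 := by
  by_contra h
  exact absurd (mem_weightLT.mp hf α (MvPolynomial.mem_support_iff.mpr h)) (not_lt.mpr hα)

theorem weightLT_mono {v w : S} (h : v ≤ w) : weightLT F γ v ≤ weightLT F γ w := fun _ hf =>
  mem_weightLT.mpr fun β hβ => (mem_weightLT.mp hf β hβ).trans_le h

theorem monomial_mem_weightLT {w : S} {α : Fin s →₀ ℕ} (h : monWeight γ α < w) (c : F) :
    MvPolynomial.monomial α c ∈ weightLT F γ w := mem_weightLT.mpr fun β hβ => by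
  rwa [Finset.mem_singleton.mp (MvPolynomial.support_monomial_subset hβ)]

theorem mul_mem_weightLT (hS : IsWellOrderedSemigroup S) {v w : S} {f g : MvPolynomial (Fin s) F}
    (hf : ∀ β ∈ f.support, monWeight γ β ≤ v) (hg : g ∈ weightLT F γ w) :
    f * g ∈ weightLT F γ (v + w) := by
  classical
  have := hS.isOrderedCancelAddMonoid
  refine mem_weightLT.mpr fun β hβ => ?_
  obtain ⟨a, ha, b, hb, rfl⟩ := Finset.mem_add.mp (MvPolynomial.support_mul f g hβ)
  rw [map_add]
  exact add_lt_add_of_le_of_lt (hf a ha) (mem_weightLT.mp hg b hb)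

theorem monomial_mul_mem_weightLT (hS : IsWellOrderedSemigroup S) {w : S}
    {g : MvPolynomial (Fin s) F} (α : Fin s →₀ ℕ) (c : F) (hg : g ∈ weightLT F γ w) :
    MvPolynomial.monomial α c * g ∈ weightLT F γ (monWeight γ α + w) :=
  mul_mem_weightLT hS (fun β hβ => by
    rw [Finset.mem_singleton.mp (MvPolynomial.support_monomial_subset hβ)]) hg

/-- An element of the Gröbner basis of an ideal of Geil--Pellikaan form consists of its leading
monomial, a smaller monomial of the same weight, and monomials of smaller weight. -/
theorem exists_eq_monomial_add_of_ncard_eq_two (hS : IsWellOrderedSemigroup S)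
    {τ : MonomialOrder (Fin s)} {g : MvPolynomial (Fin s) F}
    (h1 : (weightOrder hS γ τ).leadingCoeff g = 1)
    (h2 : {α | α ∈ g.support ∧ ∀ β ∈ g.support, monWeight γ β ≤ monWeight γ α}.ncard = 2) :
    ∃ (ν : Fin s →₀ ℕ) (c : F), c ≠ 0 ∧
      monWeight γ ν = monWeight γ ((weightOrder hS γ τ).degree g) ∧
      (weightOrder hS γ τ).toSyn ν < (weightOrder hS γ τ).toSyn ((weightOrder hS γ τ).degree g) ∧
      ∃ h ∈ weightLT F γ (monWeight γ ((weightOrder hS γ τ).degree g)),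
        g = MvPolynomial.monomial ((weightOrder hS γ τ).degree g) 1 +
          MvPolynomial.monomial ν c + h := by
  classical
  set m := weightOrder hS γ τ
  have hg0 : g ≠ 0 := by rintro rfl; simp at h1
  have hdeg : m.degree g ∈ {α | α ∈ g.support ∧ ∀ β ∈ g.support, monWeight γ β ≤ monWeight γ α} :=
    ⟨(m.degree_mem_support_iff g).mpr hg0, fun β hβ =>
      monWeight_le_of_weightOrder_le hS (m.le_degree hβ)⟩
  obtain ⟨ν, hν, hT⟩ : ∃ ν, ν ≠ m.degree g ∧
      {α | α ∈ g.support ∧ ∀ β ∈ g.support, monWeight γ β ≤ monWeight γ α} = {m.degree g, ν} := by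
    obtain ⟨a, b, hab, hT⟩ := Set.ncard_eq_two.mp h2
    rw [hT] at hdeg ⊢
    rcases hdeg with h | h
    · exact ⟨b, by rw [h]; exact hab.symm, by rw [h]⟩
    · rw [Set.mem_singleton_iff] at h
      exact ⟨a, by rw [h]; exact hab, by rw [h, Set.pair_comm]⟩
  have hνT : ν ∈ {α | α ∈ g.support ∧ ∀ β ∈ g.support, monWeight γ β ≤ monWeight γ α} := by
    rw [hT]; simp
  have hw : monWeight γ ν = monWeight γ (m.degree g) :=
    le_antisymm (hdeg.2 _ hνT.1) (hνT.2 _ hdeg.1)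
  refine ⟨ν, g.coeff ν, MvPolynomial.mem_support_iff.mp hνT.1, hw,
    lt_of_le_of_ne (m.le_degree hνT.1) fun h => hν (m.toSyn.injective h),
    g - MvPolynomial.monomial (m.degree g) 1 - MvPolynomial.monomial ν (g.coeff ν), ?_, by ring⟩
  refine mem_weightLT.mpr fun β hβ => ?_
  rw [MvPolynomial.mem_support_iff, MvPolynomial.coeff_sub, MvPolynomial.coeff_sub,
    MvPolynomial.coeff_monomial, MvPolynomial.coeff_monomial] at hβ
  have hβ1 : m.degree g ≠ β := by
    rintro rfl
    rw [if_pos rfl, if_neg hν] at hβ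
    exact hβ (by rw [← MonomialOrder.leadingCoeff, h1]; ring)
  have hβ2 : ν ≠ β := by
    rintro rfl
    rw [if_pos rfl, if_neg hν.symm] at hβ
    exact hβ (by ring)
  rw [if_neg hβ1, if_neg hβ2, sub_zero, sub_zero, ← MvPolynomial.mem_support_iff] at hβ
  -- A further monomial of top weight would be a third element of a two-element set.
  refine lt_of_le_of_ne (hdeg.2 β hβ) fun h => ?_
  have : β ∈ {α | α ∈ g.support ∧ ∀ β ∈ g.support, monWeight γ β ≤ monWeight γ α} :=
    ⟨hβ, fun δ hδ => (hdeg.2 δ hδ).trans_eq h.symm⟩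
  rw [hT] at this
  rcases this with h | h
  · exact hβ1 h.symm
  · exact hβ2 h.symm

end WeightOrder

/-! ### The relations of an order domain have Geil–Pellikaan form -/

section Kernel

variable {F : Type*} [Field F] {R : Type*} [CommRing R] [Algebra F R]
  {S : Type*} [AddCommMonoid S] [LinearOrder S] {ρ : R → WithBot S}
  {s : ℕ} {γ : Fin s → S} {x : Fin s → R}

/-- For two monomials of equal weight, a combination `X^α - c X^β` has smaller order, hence agrees
in `R` with a polynomial of smaller weight. Their difference is a relation whose leading monomial is
the larger of the two, which is thus not standard. -/
theorem IsOrderFunction.injOn_monWeight_standardMonomials_ker (hS : IsWellOrderedSemigroup S)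
    (h : IsOrderFunction F ρ) (hγ : AddSubmonoid.closure (Set.range γ) = ⊤)
    (hx : ∀ i, ρ (x i) = γ i) (τ : MonomialOrder (Fin s)) :
    Set.InjOn (monWeight γ) (standardMonomials (weightOrder hS γ τ)
      (RingHom.ker (MvPolynomial.aeval x : MvPolynomial (Fin s) F →ₐ[F] R))) := by
  classical
  intro α hα β hβ hw
  by_contra hne
  wlog hlt : (weightOrder hS γ τ).toSyn β < (weightOrder hS γ τ).toSyn α generalizing α β
  · exact this hβ hα hw.symm (Ne.symm hne) (lt_of_le_of_ne (not_lt.mp hlt) fun h =>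
      hne ((weightOrder hS γ τ).toSyn.injective h))
  obtain ⟨c, -, hc⟩ := h.exists_sub_lt (MvPolynomial.aeval x (MvPolynomial.monomial α (1 : F)))
    (MvPolynomial.aeval x (MvPolynomial.monomial β (1 : F)))
    (by rw [h.map_aeval_monomial hS hx, h.map_aeval_monomial hS hx, hw])
    (by rw [h.map_aeval_monomial hS hx]; exact WithBot.coe_ne_bot)
  rw [h.map_aeval_monomial hS hx α] at hc
  obtain ⟨f, hf, hfx⟩ := h.exists_mem_weightLT_aeval_eq hS hγ hx hc
  have hco : (MvPolynomial.monomial α 1 - c • MvPolynomial.monomial β 1 - f).coeff α = 1 := by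
    rw [MvPolynomial.coeff_sub, MvPolynomial.coeff_sub, coeff_eq_zero_of_mem_weightLT hf le_rfl]
    simp [MvPolynomial.coeff_monomial, Ne.symm hne]
  refine hα ⟨MvPolynomial.monomial α 1 - c • MvPolynomial.monomial β 1 - f, ?_, ?_, ?_⟩
  · rw [RingHom.mem_ker, map_sub, map_sub, map_smul, hfx, sub_self]
  · intro h0
    rw [h0] at hco
    simp at hco
  · refine MonomialOrder.degree_eq_of_forall_le (by rw [hco]; exact one_ne_zero) fun δ hδ => ?_
    rw [MvPolynomial.mem_support_iff, MvPolynomial.coeff_sub, MvPolynomial.coeff_sub,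
      MvPolynomial.coeff_smul, MvPolynomial.coeff_monomial, MvPolynomial.coeff_monomial] at hδ
    by_cases h1 : α = δ
    · rw [h1]
    by_cases h2 : β = δ
    · rw [← h2]; exact hlt.le
    rw [if_neg h1, if_neg h2, smul_zero, zero_sub, neg_zero, zero_sub, neg_ne_zero,
      ← MvPolynomial.mem_support_iff] at hδ
    exact (weightOrder_lt_of_monWeight_lt hS (mem_weightLT.mp hf δ hδ)).le

/-- The reduced Gröbner basis consists of the `X^α - nf α`, with `α` a minimal nonstandard exponent
and `nf α` its normal form. -/
theorem IsOrderFunction.isGeilPellikaanForm_ker (hS : IsWellOrderedSemigroup S)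
    (h : IsOrderFunction F ρ) (hγ : AddSubmonoid.closure (Set.range γ) = ⊤)
    (hx : ∀ i, ρ (x i) = γ i) (τ : MonomialOrder (Fin s)) :
    IsGeilPellikaanForm hS γ τ
      (RingHom.ker (MvPolynomial.aeval x : MvPolynomial (Fin s) F →ₐ[F] R)) := by
  classical
  have hinj := h.injOn_monWeight_standardMonomials_ker hS hγ hx τ
  refine ⟨?_, hinj⟩
  set m := weightOrder hS γ τ with hm
  set I := RingHom.ker (MvPolynomial.aeval x : MvPolynomial (Fin s) F →ₐ[F] R) with hI
  choose nf hnf using fun α => exists_normalForm m I (MvPolynomial.monomial α (1 : F))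
  have hnfI := fun α => (hnf α).1
  have hnfS := fun α => (hnf α).2.1
  have hnfL : ∀ α, ∀ β ∈ (nf α).support, m.toSyn β ≤ m.toSyn α := fun α β hβ => by
    have := (hnf α).2.2 β hβ
    rwa [m.degree_monomial, if_neg one_ne_zero] at this
  let T : Set (Fin s →₀ ℕ) := {α | Minimal (fun a => a ∉ standardMonomials m I) α}
  have hT : T.Finite := by
    -- Dickson's lemma: antichains of exponents are finite.
    have hanti : IsAntichain (· ≤ ·) T := setOfPred_minimal_antichain _
    exact WellQuasiOrderedLE.finite_of_isAntichain hanti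
  have hTmin : ∀ α ∈ hT.toFinset, Minimal (fun a => a ∉ standardMonomials m I) α :=
    fun α hα => hT.mem_toFinset.mp hα
  have hsupp : ∀ α, α ∉ standardMonomials m I → ∀ β,
      β ∈ (MvPolynomial.monomial α 1 - nf α).support ↔ β = α ∨ β ∈ (nf α).support := by
    intro α hα β
    rw [MvPolynomial.mem_support_iff, MvPolynomial.coeff_sub, MvPolynomial.coeff_monomial,
      MvPolynomial.mem_support_iff]
    have hα0 : (nf α).coeff α = 0 := by
      by_contra h0
      exact hα (hnfS α α (MvPolynomial.mem_support_iff.mpr h0))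
    by_cases hβ : α = β
    · subst hβ; simp [hα0]
    · simp [hβ, Ne.symm hβ]
  have hcoeff : ∀ α, α ∉ standardMonomials m I →
      (MvPolynomial.monomial α 1 - nf α).coeff α = 1 := by
    intro α hα
    have hα0 : (nf α).coeff α = 0 := by
      by_contra h0
      exact hα (hnfS α α (MvPolynomial.mem_support_iff.mpr h0))
    rw [MvPolynomial.coeff_sub, MvPolynomial.coeff_monomial, hα0]
    simp
  have hdeg : ∀ α, α ∉ standardMonomials m I →
      m.degree (MvPolynomial.monomial α 1 - nf α) = α := by
    intro α hα
    refine MonomialOrder.degree_eq_of_forall_le (by rw [hcoeff α hα]; exact one_ne_zero) ?_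
    intro β hβ
    rcases (hsupp α hα β).mp hβ with rfl | hβ
    · exact le_rfl
    · exact hnfL α β hβ
  refine ⟨hT.toFinset.image fun α => MvPolynomial.monomial α 1 - nf α, ⟨?_, ?_, ?_, ?_⟩, ?_⟩
  · intro g hg
    obtain ⟨α, -, rfl⟩ := Finset.mem_image.mp hg
    exact hnfI α
  · intro f hf hf0
    obtain ⟨α, hα, hmin⟩ := exists_minimal_le_of_wellFoundedLT
      (fun a => a ∉ standardMonomials m I) (m.degree f)
      (not_mem_standardMonomials_of_le hf hf0 le_rfl)
    refine ⟨_, Finset.mem_image_of_mem _ (hT.mem_toFinset.mpr hmin), ?_⟩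
    rwa [hdeg α hmin.prop]
  · intro g hg
    obtain ⟨α, hα, rfl⟩ := Finset.mem_image.mp hg
    have hα := (hTmin α hα).prop
    rw [MonomialOrder.leadingCoeff, hdeg α hα, hcoeff α hα]
  · intro g hg f hf hfg δ hδ hle
    obtain ⟨α, hα, rfl⟩ := Finset.mem_image.mp hg
    obtain ⟨β, hβ, rfl⟩ := Finset.mem_image.mp hf
    have hα := hTmin α hα
    have hβ := hTmin β hβ
    rw [hdeg β hβ.prop] at hle
    -- A leading exponent `β` below `α` equals `α` by minimality; the other exponents are standard
    -- and have no nonstandard divisor.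
    rcases (hsupp α hα.prop δ).mp hδ with rfl | hδ
    · exact hfg (by rw [hα.eq_of_le hβ.prop hle])
    · refine not_mem_standardMonomials_of_le (m := m) (hnfI β) ?_ ?_ (hnfS α δ hδ)
      · intro h0
        have := hcoeff β hβ.prop
        rw [h0] at this
        simp at this
      · rwa [hdeg β hβ.prop]
  · intro g hg
    obtain ⟨α, hα, rfl⟩ := Finset.mem_image.mp hg
    have hα := (hTmin α hα).prop
    -- If all of `nf α` had smaller weight, its value in `R`, which is that of `X^α`, would have
    -- order below the weight of `X^α`. Such a `ν` is unique because standard monomials have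
    -- distinct weights.
    obtain ⟨ν, hν, hνw⟩ : ∃ ν ∈ (nf α).support, monWeight γ ν = monWeight γ α := by
      by_contra! hcon
      have hlt : nf α ∈ weightLT F γ (monWeight γ α) := mem_weightLT.mpr fun β hβ =>
        lt_of_le_of_ne (monWeight_le_of_weightOrder_le hS (hnfL α β hβ)) (hcon β hβ)
      have h1 := h.aeval_mem_ltSubmodule hS hx hlt
      have h2 := hnfI α
      rw [hI, RingHom.mem_ker, map_sub, sub_eq_zero] at h2
      rw [h.mem_ltSubmodule, ← h2, h.map_aeval_monomial hS hx] at h1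
      exact lt_irrefl _ h1
    have hαν : α ≠ ν := by
      rintro rfl
      exact hα (hnfS _ _ hν)
    rw [Set.ncard_eq_two]
    refine ⟨α, ν, hαν, Set.ext fun η => ⟨?_, ?_⟩⟩
    · rintro ⟨h1, h2⟩
      rcases (hsupp α hα η).mp h1 with rfl | h1
      · simp
      · right
        refine hinj (hnfS α η h1) (hnfS α ν hν) ?_
        rw [hνw]
        exact le_antisymm (monWeight_le_of_weightOrder_le hS (hnfL α η h1))
          (h2 α ((hsupp α hα α).mpr (.inl rfl)))
    · have hmax : ∀ β ∈ (MvPolynomial.monomial α 1 - nf α).support,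
          monWeight γ β ≤ monWeight γ α := by
        intro β hβ
        rcases (hsupp α hα β).mp hβ with rfl | hβ
        · exact le_rfl
        · exact monWeight_le_of_weightOrder_le hS (hnfL α β hβ)
      rintro (rfl | rfl)
      · exact ⟨(hsupp _ hα _).mpr (.inl rfl), hmax⟩
      · exact ⟨(hsupp _ hα _).mpr (.inr hν), by rwa [hνw]⟩

end Kernel

/-! ### The order function of an ideal of Geil–Pellikaan form -/

section Converse

variable {F : Type*} [Field F] {S : Type*} [AddCommMonoid S] [LinearOrder S]
  {s : ℕ} {γ : Fin s → S} {m : MonomialOrder (Fin s)} {I : Ideal (MvPolynomial (Fin s) F)}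

/-- Modulo `I`, the polynomial `f` is the sum of the standard term `c X^δ`, where `c ≠ 0`, and of
terms of smaller weight. -/
structure HasStandardTop (γ : Fin s → S) (m : MonomialOrder (Fin s))
    (I : Ideal (MvPolynomial (Fin s) F)) (f : MvPolynomial (Fin s) F) (δ : Fin s →₀ ℕ) (c : F) :
    Prop where
  ne_zero : c ≠ 0
  standard : δ ∈ standardMonomials m I
  exists_sub_mem : ∃ i ∈ I, f - i - MvPolynomial.monomial δ c ∈ weightLT F γ (monWeight γ δ)

theorem HasStandardTop.of_sub_mem {f g : MvPolynomial (Fin s) F} {δ : Fin s →₀ ℕ} {c : F}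
    (h : HasStandardTop γ m I f δ c) (hfg : g - f ∈ I) : HasStandardTop γ m I g δ c := by
  obtain ⟨i, hi, hfi⟩ := h.exists_sub_mem
  refine ⟨h.ne_zero, h.standard, i + (g - f), I.add_mem hi hfg, ?_⟩
  convert hfi using 1
  ring

theorem HasStandardTop.add_of_mem_weightLT {f g : MvPolynomial (Fin s) F} {δ : Fin s →₀ ℕ} {c : F}
    (h : HasStandardTop γ m I f δ c) (hg : g ∈ weightLT F γ (monWeight γ δ)) :
    HasStandardTop γ m I (f + g) δ c := by
  obtain ⟨i, hi, hfi⟩ := h.exists_sub_mem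
  refine ⟨h.ne_zero, h.standard, i, hi, ?_⟩
  convert Submodule.add_mem _ hfi hg using 1
  ring

theorem HasStandardTop.smul {f : MvPolynomial (Fin s) F} {δ : Fin s →₀ ℕ} {c : F}
    (h : HasStandardTop γ m I f δ c) {a : F} (ha : a ≠ 0) :
    HasStandardTop γ m I (a • f) δ (a * c) := by
  obtain ⟨i, hi, hfi⟩ := h.exists_sub_mem
  refine ⟨mul_ne_zero ha h.ne_zero, h.standard, a • i, Submodule.smul_of_tower_mem I a hi, ?_⟩
  convert Submodule.smul_mem _ a hfi using 1
  rw [smul_sub, smul_sub, MvPolynomial.smul_monomial, smul_eq_mul]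

theorem HasStandardTop.add_of_lt {f g : MvPolynomial (Fin s) F} {δ ε : Fin s →₀ ℕ} {c d : F}
    (hf : HasStandardTop γ m I f δ c) (hg : HasStandardTop γ m I g ε d)
    (hlt : monWeight γ ε < monWeight γ δ) : HasStandardTop γ m I (f + g) δ c := by
  obtain ⟨i, hi, hfi⟩ := hf.exists_sub_mem
  obtain ⟨j, hj, hgj⟩ := hg.exists_sub_mem
  refine ⟨hf.ne_zero, hf.standard, i + j, I.add_mem hi hj, ?_⟩
  convert Submodule.add_mem _ hfi (Submodule.add_mem _ (weightLT_mono hlt.le hgj)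
    (monomial_mem_weightLT hlt d)) using 1
  ring

/-- The two tops may cancel, so no standard top is claimed for the sum. The case `c + d = 0` is the
one behind axiom (4). -/
theorem HasStandardTop.exists_add_mem {f g : MvPolynomial (Fin s) F} {δ : Fin s →₀ ℕ} {c d : F}
    (hf : HasStandardTop γ m I f δ c) (hg : HasStandardTop γ m I g δ d) :
    ∃ i ∈ I, f + g - i - MvPolynomial.monomial δ (c + d) ∈ weightLT F γ (monWeight γ δ) := by
  obtain ⟨i, hi, hfi⟩ := hf.exists_sub_mem
  obtain ⟨j, hj, hgj⟩ := hg.exists_sub_mem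
  refine ⟨i + j, I.add_mem hi hj, ?_⟩
  convert Submodule.add_mem _ hfi hgj using 1
  rw [map_add]
  ring

theorem hasStandardTop_monomial {δ : Fin s →₀ ℕ} (hδ : δ ∈ standardMonomials m I) {c : F}
    (hc : c ≠ 0) : HasStandardTop γ m I (MvPolynomial.monomial δ c) δ c :=
  ⟨hc, hδ, 0, I.zero_mem, by simp⟩

variable {τ : MonomialOrder (Fin s)}

/-- Otherwise `f - i` would be an element of `I` with the standard leading monomial `X^δ`. -/
theorem HasStandardTop.not_mem {hS : IsWellOrderedSemigroup S} {f : MvPolynomial (Fin s) F}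
    {δ : Fin s →₀ ℕ} {c : F} (h : HasStandardTop γ (weightOrder hS γ τ) I f δ c) : f ∉ I := by
  classical
  intro hf
  obtain ⟨i, hi, hfi⟩ := h.exists_sub_mem
  have hco : (f - i).coeff δ = c := by
    have := coeff_eq_zero_of_mem_weightLT hfi le_rfl
    rw [MvPolynomial.coeff_sub, MvPolynomial.coeff_monomial, if_pos rfl] at this
    exact sub_eq_zero.mp this
  refine h.standard ⟨f - i, I.sub_mem hf hi, ?_, ?_⟩
  · intro h0
    rw [h0] at hco
    exact h.ne_zero hco.symm
  · refine MonomialOrder.degree_eq_of_forall_le (by rw [hco]; exact h.ne_zero) fun β hβ => ?_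
    by_cases hδβ : δ = β
    · rw [hδβ]
    · refine (weightOrder_lt_of_monWeight_lt hS (mem_weightLT.mp hfi β ?_)).le
      rw [MvPolynomial.mem_support_iff, MvPolynomial.coeff_sub, MvPolynomial.coeff_monomial,
        if_neg hδβ, sub_zero]
      exact MvPolynomial.mem_support_iff.mp hβ

/-- If the weights differed, the heavier top would survive in `f - f = 0`, which lies in `I`. -/
theorem HasStandardTop.monWeight_eq {hS : IsWellOrderedSemigroup S} {f : MvPolynomial (Fin s) F}
    {δ ε : Fin s →₀ ℕ} {c d : F} (h : HasStandardTop γ (weightOrder hS γ τ) I f δ c)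
    (h' : HasStandardTop γ (weightOrder hS γ τ) I f ε d) : monWeight γ δ = monWeight γ ε := by
  by_contra hne
  wlog hlt : monWeight γ ε < monWeight γ δ generalizing δ ε c d
  · exact this h' h (Ne.symm hne) (lt_of_le_of_ne (not_lt.mp hlt) hne)
  have h1 := h.add_of_lt (h'.smul (neg_ne_zero.mpr one_ne_zero)) hlt
  refine h1.not_mem ?_
  simp

theorem HasStandardTop.monWeight_lt {hS : IsWellOrderedSemigroup S} {f : MvPolynomial (Fin s) F}
    {δ : Fin s →₀ ℕ} {c : F} {w : S} (h : HasStandardTop γ (weightOrder hS γ τ) I f δ c)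
    (hf : ∃ i ∈ I, f - i ∈ weightLT F γ w) : monWeight γ δ < w := by
  by_contra hlt
  obtain ⟨i, hi, hfi⟩ := hf
  have h1 : HasStandardTop γ (weightOrder hS γ τ) I (f - i) δ c :=
    h.of_sub_mem (by simpa using hi)
  refine (h1.add_of_mem_weightLT
    (weightLT_mono (not_lt.mp hlt) (Submodule.neg_mem _ hfi))).not_mem ?_
  simp

/-! ### Reduction to standard tops, and the axioms of an order function -/

namespace IsGeilPellikaanForm

/-- A Gröbner basis element replaces a nonstandard monomial by its second top monomial, which is
smaller in the monomial order. The weight is kept and the coefficient stays nonzero; this is where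
two top monomials, rather than one, are needed. -/
theorem exists_hasStandardTop_monomial {hS : IsWellOrderedSemigroup S}
    (hI : IsGeilPellikaanForm hS γ τ I) (α : Fin s →₀ ℕ) {a : F} (ha : a ≠ 0) :
    ∃ δ c, monWeight γ δ = monWeight γ α ∧
      HasStandardTop γ (weightOrder hS γ τ) I (MvPolynomial.monomial α a) δ c := by
  obtain ⟨⟨G, hG, h2⟩, -⟩ := hI
  set m := weightOrder hS γ τ with hm
  have hwf := m.wellFoundedLT_syn
  induction hα : m.toSyn α using WellFoundedLT.induction generalizing α a with
  | _ v ih =>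
  subst hα
  by_cases hstd : α ∈ standardMonomials m I
  · exact ⟨α, a, rfl, hasStandardTop_monomial hstd ha⟩
  · obtain ⟨f, hf, hf0, rfl⟩ := not_not.mp hstd
    obtain ⟨g, hg, hle⟩ := hG.exists_degree_le f hf hf0
    obtain ⟨ν, c, hc, hνw, hνlt, h, hh, hgeq⟩ :=
      exists_eq_monomial_add_of_ncard_eq_two hS (hG.monic g hg) (h2 g hg)
    rw [← hm] at hνw hνlt hh hgeq
    set η := m.degree f - m.degree g
    have hη : m.degree f = η + m.degree g := (tsub_add_cancel_of_le hle).symm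
    have hw : monWeight γ (η + ν) = monWeight γ (m.degree f) := by
      rw [hη, map_add, map_add, hνw]
    obtain ⟨δ, d, hδ, htop⟩ := ih (m.toSyn (η + ν))
      (by rw [hη, map_add, map_add]; gcongr) (η + ν) (a := -(a * c))
      (neg_ne_zero.mpr (mul_ne_zero ha hc)) rfl
    refine ⟨δ, d, hδ.trans hw, ?_⟩
    have hlow : -(MvPolynomial.monomial η a * h) ∈ weightLT F γ (monWeight γ δ) := by
      rw [hδ, hw, hη, map_add]
      exact Submodule.neg_mem _ (monomial_mul_mem_weightLT hS _ _ hh)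
    refine (htop.add_of_mem_weightLT hlow).of_sub_mem ?_
    have : MvPolynomial.monomial (m.degree f) a - (MvPolynomial.monomial (η + ν) (-(a * c)) +
        -(MvPolynomial.monomial η a * h)) = MvPolynomial.monomial η a * g := by
      rw [hη]
      conv_rhs => rw [hgeq]
      rw [mul_add, mul_add, MvPolynomial.monomial_mul, MvPolynomial.monomial_mul, mul_one, map_neg]
      ring
    rw [this]
    exact I.mul_mem_left _ (hG.mem g hg)

/-- Induction on a bound `w` for the weights. All terms of weight `w` reduce to multiples of a
single standard monomial; either their sum is nonzero and is the top, or the bound drops. -/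
theorem mem_or_exists_hasStandardTop {hS : IsWellOrderedSemigroup S}
    (hI : IsGeilPellikaanForm hS γ τ I) (f : MvPolynomial (Fin s) F) :
    f ∈ I ∨ ∃ δ c, HasStandardTop γ (weightOrder hS γ τ) I f δ c := by
  classical
  have : WellFoundedLT S := ⟨hS.wf⟩
  by_cases hf0 : f = 0
  · left; rw [hf0]; exact I.zero_mem
  obtain ⟨β, hβ⟩ := MvPolynomial.support_nonempty.mpr hf0
  obtain ⟨w, hw⟩ : ∃ w, ∀ β ∈ f.support, monWeight γ β ≤ w :=
    ⟨f.support.sup' ⟨β, hβ⟩ (monWeight γ), fun β hβ => Finset.le_sup' (monWeight γ) hβ⟩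
  clear hf0 hβ
  induction w using WellFoundedLT.induction generalizing f with
  | _ w ih =>
  by_cases hex : ∃ α ∈ f.support, monWeight γ α = w
  · obtain ⟨α, hα, rfl⟩ := hex
    obtain ⟨δ, c, hδ, htop⟩ := hI.exists_hasStandardTop_monomial α (a := (1 : F)) one_ne_zero
    have key : ∀ p : MvPolynomial (Fin s) F, (∀ β ∈ p.support, monWeight γ β ≤ monWeight γ α) →
        ∃ i ∈ I, ∃ d : F, p - i - MvPolynomial.monomial δ d ∈ weightLT F γ (monWeight γ α) := by
      intro p hp
      have hmon : ∀ β, monWeight γ β ≤ monWeight γ α → ∀ a : F, ∃ i ∈ I, ∃ d : F,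
          MvPolynomial.monomial β a - i - MvPolynomial.monomial δ d ∈
            weightLT F γ (monWeight γ α) := by
        intro β hβ a
        rcases eq_or_ne a 0 with rfl | ha
        · exact ⟨0, I.zero_mem, 0, by simp⟩
        rcases hβ.eq_or_lt with hβ | hβ
        · obtain ⟨δ', c', hδ', htop'⟩ := hI.exists_hasStandardTop_monomial β ha
          -- Distinct weights of standard monomials enter here: all terms of top weight share one
          -- standard monomial.
          have : δ' = δ := hI.2 htop'.standard htop.standard (by rw [hδ', hβ, hδ])
          subst this
          obtain ⟨i, hi, h⟩ := htop'.exists_sub_mem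
          exact ⟨i, hi, c', by rwa [hδ', hβ] at h⟩
        · exact ⟨0, I.zero_mem, 0, by simpa using monomial_mem_weightLT hβ a⟩
      choose! i hi d hd using hmon
      refine ⟨∑ β ∈ p.support, i β (p.coeff β), I.sum_mem fun β hβ => hi β (hp β hβ) _,
        ∑ β ∈ p.support, d β (p.coeff β), ?_⟩
      have : p - ∑ β ∈ p.support, i β (p.coeff β) -
          MvPolynomial.monomial δ (∑ β ∈ p.support, d β (p.coeff β)) =
          ∑ β ∈ p.support, (MvPolynomial.monomial β (p.coeff β) - i β (p.coeff β) -
            MvPolynomial.monomial δ (d β (p.coeff β))) := by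
        rw [Finset.sum_sub_distrib, Finset.sum_sub_distrib, ← p.as_sum, map_sum]
      rw [this]
      exact Submodule.sum_mem _ fun β hβ => hd β (hp β hβ) _
    obtain ⟨i, hi, d, hd⟩ := key f hw
    rcases eq_or_ne d 0 with rfl | hd0
    · rw [MvPolynomial.monomial_zero, sub_zero] at hd
      by_cases hfi : f - i = 0
      · left
        rwa [sub_eq_zero.mp hfi]
      obtain ⟨β, hβ⟩ := MvPolynomial.support_nonempty.mpr hfi
      have hlt : (f - i).support.sup' ⟨β, hβ⟩ (monWeight γ) < monWeight γ α :=
        (Finset.sup'_lt_iff _).mpr fun β hβ => mem_weightLT.mp hd β hβ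
      rcases ih _ hlt (f - i) fun β hβ => Finset.le_sup' (monWeight γ) hβ with h | ⟨ε, e, h⟩
      · left
        simpa using I.add_mem h hi
      · right
        exact ⟨ε, e, h.of_sub_mem (by simpa using hi)⟩
    · exact .inr ⟨δ, d, hd0, htop.standard, i, hi, by rwa [hδ]⟩
  · by_cases hf0 : f = 0
    · left; rw [hf0]; exact I.zero_mem
    push Not at hex
    obtain ⟨β, hβ⟩ := MvPolynomial.support_nonempty.mpr hf0
    have hlt : f.support.sup' ⟨β, hβ⟩ (monWeight γ) < w :=
      (Finset.sup'_lt_iff _).mpr fun β hβ => lt_of_le_of_ne (hw β hβ) (hex β hβ)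
    exact ih _ hlt f fun β hβ => Finset.le_sup' (monWeight γ) hβ

theorem exists_hasStandardTop_mul {hS : IsWellOrderedSemigroup S}
    (hI : IsGeilPellikaanForm hS γ τ I) {f g : MvPolynomial (Fin s) F} {δ ε : Fin s →₀ ℕ}
    {c d : F} (hf : HasStandardTop γ (weightOrder hS γ τ) I f δ c)
    (hg : HasStandardTop γ (weightOrder hS γ τ) I g ε d) :
    ∃ κ e, monWeight γ κ = monWeight γ δ + monWeight γ ε ∧
      HasStandardTop γ (weightOrder hS γ τ) I (f * g) κ e := by
  obtain ⟨κ, e, hκ, htop⟩ :=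
    hI.exists_hasStandardTop_monomial (δ + ε) (mul_ne_zero hf.ne_zero hg.ne_zero)
  obtain ⟨i, hi, hfi⟩ := hf.exists_sub_mem
  obtain ⟨j, hj, hgj⟩ := hg.exists_sub_mem
  rw [map_add] at hκ
  refine ⟨κ, e, hκ, ?_⟩
  set p := f - i - MvPolynomial.monomial δ c with hp
  set q := g - j - MvPolynomial.monomial ε d with hq
  have hlow : MvPolynomial.monomial δ c * q + MvPolynomial.monomial ε d * p + p * q ∈
      weightLT F γ (monWeight γ κ) := by
    rw [hκ]
    refine Submodule.add_mem _ (Submodule.add_mem _ (monomial_mul_mem_weightLT hS _ _ hgj) ?_)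
      (mul_mem_weightLT hS (fun β hβ => (mem_weightLT.mp hfi β hβ).le) hgj)
    rw [add_comm]
    exact monomial_mul_mem_weightLT hS _ _ hfi
  refine (htop.add_of_mem_weightLT hlow).of_sub_mem ?_
  have : f * g - (MvPolynomial.monomial (δ + ε) (c * d) + (MvPolynomial.monomial δ c * q +
      MvPolynomial.monomial ε d * p + p * q)) = i * g + (f - i) * j := by
    rw [← MvPolynomial.monomial_mul, hp, hq]
    ring
  rw [this]
  exact I.add_mem (I.mul_mem_right _ hi) (I.mul_mem_left _ hj)

theorem exists_isOrderFunction {hS : IsWellOrderedSemigroup S}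
    (hI : IsGeilPellikaanForm hS γ τ I) (hγ : AddSubmonoid.closure (Set.range γ) = ⊤) :
    ∃ ρ : MvPolynomial (Fin s) F ⧸ I → WithBot S, IsOrderFunction F ρ ∧ IsMaxWeight hS γ τ I ρ := by
  classical
  let P : MvPolynomial (Fin s) F ⧸ I → S → Prop := fun x w => ∃ f δ c,
    Ideal.Quotient.mk I f = x ∧ HasStandardTop γ (weightOrder hS γ τ) I f δ c ∧ monWeight γ δ = w
  let ρ : MvPolynomial (Fin s) F ⧸ I → WithBot S := fun x =>
    if h : ∃ w, P x w then (h.choose : WithBot S) else ⊥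
  have hρ : ∀ {f δ c}, HasStandardTop γ (weightOrder hS γ τ) I f δ c →
      ρ (Ideal.Quotient.mk I f) = monWeight γ δ := by
    intro f δ c h
    have hex : ∃ w, P (Ideal.Quotient.mk I f) w := ⟨_, f, δ, c, rfl, h, rfl⟩
    obtain ⟨g, ε, d, hgf, hg, hw⟩ := hex.choose_spec
    have h1 : ρ (Ideal.Quotient.mk I f) = (hex.choose : WithBot S) := dif_pos hex
    rw [h1, ← hw, (hg.of_sub_mem (Ideal.Quotient.eq.mp hgf.symm)).monWeight_eq h]
  have hρ0 : ρ 0 = ⊥ := by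
    refine dif_neg ?_
    rintro ⟨w, f, δ, c, hf0, hf, -⟩
    exact hf.not_mem (Ideal.Quotient.eq_zero_iff_mem.mp hf0)
  have hcase : ∀ x : MvPolynomial (Fin s) F ⧸ I, x = 0 ∨ ∃ f δ c, Ideal.Quotient.mk I f = x ∧
      HasStandardTop γ (weightOrder hS γ τ) I f δ c := by
    intro x
    obtain ⟨f, rfl⟩ := Ideal.Quotient.mk_surjective x
    rcases hI.mem_or_exists_hasStandardTop f with h | ⟨δ, c, h⟩
    · exact .inl (Ideal.Quotient.eq_zero_iff_mem.mpr h)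
    · exact .inr ⟨f, δ, c, rfl, h⟩
  have hlow : ∀ {f w}, (∃ i ∈ I, f - i ∈ weightLT F γ w) → ρ (Ideal.Quotient.mk I f) < w := by
    intro f w hf
    rcases hI.mem_or_exists_hasStandardTop f with h | ⟨δ, c, h⟩
    · rw [Ideal.Quotient.eq_zero_iff_mem.mpr h, hρ0]
      exact WithBot.bot_lt_coe w
    · rw [hρ h]
      exact WithBot.coe_lt_coe.mpr (h.monWeight_lt hf)
  refine ⟨ρ, ⟨?_, ?_, ?_, ?_, ?_, ?_⟩, ?_⟩
  · intro w
    induction w using WithBot.recBotCoe with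
    | bot => exact ⟨0, hρ0⟩
    | coe w =>
      obtain ⟨α, rfl⟩ := monWeight_surjective hγ w
      obtain ⟨δ, c, hδ, h⟩ := hI.exists_hasStandardTop_monomial α (a := (1 : F)) one_ne_zero
      exact ⟨_, by rw [hρ h, hδ]⟩
  · intro x
    rcases hcase x with rfl | ⟨f, δ, c, rfl, h⟩
    · simp [hρ0]
    · rw [hρ h]
      simp only [WithBot.coe_ne_bot, false_iff]
      intro h0
      exact h.not_mem (Ideal.Quotient.eq_zero_iff_mem.mp h0)
  · intro a x ha
    rcases hcase x with rfl | ⟨f, δ, c, rfl, h⟩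
    · rw [smul_zero]
    · rw [hρ h]
      exact hρ (h.smul ha)
  · intro x y
    rcases hcase x with rfl | ⟨f, δ, c, rfl, hf⟩
    · rw [zero_add]; exact le_max_right _ _
    rcases hcase y with rfl | ⟨g, ε, d, rfl, hg⟩
    · rw [add_zero]; exact le_max_left _ _
    rw [← map_add, hρ hf, hρ hg]
    rcases lt_trichotomy (monWeight γ δ) (monWeight γ ε) with hlt | heq | hlt
    · rw [add_comm, hρ (hg.add_of_lt hf hlt)]
      exact le_max_right _ _
    · obtain rfl := hI.2 hf.standard hg.standard heq
      obtain ⟨i, hi, h⟩ := hf.exists_add_mem hg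
      rw [max_self]
      rcases eq_or_ne (c + d) 0 with h0 | h0
      · rw [h0, MvPolynomial.monomial_zero, sub_zero] at h
        exact (hlow ⟨i, hi, h⟩).le
      · exact (hρ ⟨h0, hf.standard, i, hi, h⟩).le
    · rw [hρ (hf.add_of_lt hg hlt)]
      exact le_max_left _ _
  · intro x y hxy hx
    rcases hcase x with rfl | ⟨f, δ, c, rfl, hf⟩
    · exact absurd hρ0 hx
    rcases hcase y with rfl | ⟨g, ε, d, rfl, hg⟩
    · exact absurd (hxy.trans hρ0) hx
    rw [hρ hf, hρ hg, WithBot.coe_inj] at hxy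
    obtain rfl := hI.2 hf.standard hg.standard hxy
    -- Equal orders mean the same standard monomial, so the quotient of the coefficients cancels the
    -- tops.
    have hcd : c / d ≠ 0 := div_ne_zero hf.ne_zero hg.ne_zero
    refine ⟨c / d, hcd, ?_⟩
    obtain ⟨i, hi, h⟩ := hf.exists_add_mem (hg.smul (neg_ne_zero.mpr hcd))
    rw [neg_mul, div_mul_cancel₀ _ hg.ne_zero, add_neg_cancel, MvPolynomial.monomial_zero,
      sub_zero] at h
    have h1 := hlow ⟨i, hi, h⟩
    rw [hρ hf]
    rw [map_add, neg_smul, map_neg, ← sub_eq_add_neg] at h1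
    exact h1
  · intro x y
    rcases hcase x with rfl | ⟨f, δ, c, rfl, hf⟩
    · rw [zero_mul, hρ0, WithBot.bot_add]
    rcases hcase y with rfl | ⟨g, ε, d, rfl, hg⟩
    · rw [mul_zero, hρ0, WithBot.add_bot]
    obtain ⟨κ, e, hκ, h⟩ := hI.exists_hasStandardTop_mul hf hg
    rw [← map_mul, hρ h, hρ hf, hρ hg, hκ]
    rfl
  · intro f hf
    rcases eq_or_ne f 0 with rfl | hf0
    · simp [hρ0]
    obtain ⟨δ, hδ, hmax⟩ := Finset.exists_max_image f.support (monWeight γ)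
      (MvPolynomial.support_nonempty.mpr hf0)
    have htop : HasStandardTop γ (weightOrder hS γ τ) I f δ (f.coeff δ) := by
      refine ⟨MvPolynomial.mem_support_iff.mp hδ, hf δ hδ, 0, I.zero_mem,
        mem_weightLT.mpr fun β hβ => ?_⟩
      rw [sub_zero, MvPolynomial.mem_support_iff, MvPolynomial.coeff_sub,
        MvPolynomial.coeff_monomial] at hβ
      have hne : δ ≠ β := by
        rintro rfl
        simp at hβ
      rw [if_neg hne, sub_zero, ← MvPolynomial.mem_support_iff] at hβ
      exact lt_of_le_of_ne (hmax β hβ) fun h => hne (hI.2 (hf β hβ) (hf δ hδ) h).symm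
    rw [hρ htop]
    exact le_antisymm (Finset.le_sup (f := fun β => (monWeight γ β : WithBot S)) hδ)
      (Finset.sup_le fun β hβ => WithBot.coe_le_coe.mpr (hmax β hβ))

end IsGeilPellikaanForm

end Converse

/-! ### The toric algebra and the toric ideal -/

section Toric

variable {F : Type*} [Field F] {r : ℕ} {Γ : AddSubmonoid (Fin r → ℕ)} {s : ℕ} {γ : Fin s → Γ}

theorem toricMonomial_eq_monomial (u : Fin r → ℕ) :
    toricMonomial F u = MvPolynomial.monomial (Finsupp.equivFunOnFinite.symm u) 1 := by
  rw [toricMonomial, MvPolynomial.monomial_eq, Finsupp.prod_fintype _ _ (by simp)]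
  simp

theorem toricMonomial_mem (w : Γ) : toricMonomial F (w : Fin r → ℕ) ∈ toricAlgebra F Γ :=
  Algebra.subset_adjoin ⟨w, w.2, rfl⟩

/-- The homomorphism `F[X₁, …, X_s] → F[Γ]`, `X_i ↦ T^{γ_i}`. -/
noncomputable def toricMap (F : Type*) [Field F] (γ : Fin s → Γ) :
    MvPolynomial (Fin s) F →ₐ[F] toricAlgebra F Γ :=
  MvPolynomial.aeval fun i => ⟨toricMonomial F (γ i : Fin r → ℕ), toricMonomial_mem (γ i)⟩

theorem coe_toricMap_monomial (α : Fin s →₀ ℕ) (c : F) :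
    (toricMap F γ (MvPolynomial.monomial α c) : MvPolynomial (Fin r) F) =
      MvPolynomial.monomial (Finsupp.equivFunOnFinite.symm (monWeight γ α : Fin r → ℕ)) c := by
  have h1 : (toricMap F γ (MvPolynomial.monomial α 1) : MvPolynomial (Fin r) F) =
      MvPolynomial.monomial (Finsupp.equivFunOnFinite.symm (monWeight γ α : Fin r → ℕ)) 1 := by
    induction α using Finsupp.induction_linear with
    | zero =>
      rw [map_zero, MvPolynomial.monomial_zero', MvPolynomial.C_1, map_one]
      simp [← Finsupp.coe_zero]
    | add a b ha hb =>
      have hab : MvPolynomial.monomial (a + b) (1 : F) =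
        MvPolynomial.monomial a 1 * MvPolynomial.monomial b 1 := by
          simp [MvPolynomial.monomial_mul]
      rw [hab, map_mul, MulMemClass.coe_mul, ha, hb, MvPolynomial.monomial_mul, mul_one, map_add]
      congr 2
      ext i
      simp
    | single i n =>
      rw [toricMap, MvPolynomial.aeval_monomial, map_one, one_mul,
        Finsupp.prod_single_index (by simp), SubmonoidClass.coe_pow]
      change toricMonomial F (γ i : Fin r → ℕ) ^ n = _
      rw [toricMonomial_eq_monomial, MvPolynomial.monomial_pow, one_pow]
      congr 2
      ext j
      simp [monWeight, Finsupp.weight_single]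
  have h2 : MvPolynomial.monomial α c = c • MvPolynomial.monomial α (1 : F) := by
    simp [MvPolynomial.smul_monomial]
  rw [h2, map_smul, SetLike.val_smul, h1, MvPolynomial.smul_monomial, smul_eq_mul, mul_one]

theorem toricMap_surjective (hγ : AddSubmonoid.closure (Set.range γ) = ⊤) :
    Function.Surjective (toricMap F γ) := by
  have hle : toricAlgebra F Γ ≤ ((toricAlgebra F Γ).val.comp (toricMap F γ)).range := by
    refine Algebra.adjoin_le ?_
    rintro _ ⟨w, hw, rfl⟩
    obtain ⟨α, hα⟩ := monWeight_surjective hγ ⟨w, hw⟩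
    refine ⟨MvPolynomial.monomial α 1, ?_⟩
    rw [toricMonomial_eq_monomial]
    exact (coe_toricMap_monomial α 1).trans (by rw [hα])
  rintro ⟨y, hy⟩
  obtain ⟨f, hf⟩ := hle hy
  exact ⟨f, Subtype.ext hf⟩

/-- Choosing one monomial `X^{σ w}` for each `w` in `Γ` gives a linear section `L` of `toricMap`.
Each polynomial differs from its image under `L ∘ toricMap` by a combination of binomials, and this
image is zero on the kernel. -/
theorem ker_toricMap (hγ : AddSubmonoid.closure (Set.range γ) = ⊤) :
    RingHom.ker (toricMap F γ) = toricIdeal F γ := by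
  classical
  refine le_antisymm ?_ ?_
  · choose σ hσ using monWeight_surjective hγ
    let L : MvPolynomial (Fin r) F →ₗ[F] MvPolynomial (Fin s) F :=
      (MvPolynomial.basisMonomials (Fin r) F).constr F fun u =>
        -- The value `0` outside `Γ` is immaterial: `L` is only applied to elements of the toric
        -- algebra.
        if h : (u : Fin r → ℕ) ∈ Γ then MvPolynomial.monomial (σ ⟨u, h⟩) 1 else 0
    have hL : ∀ w : Γ, L (MvPolynomial.monomial (Finsupp.equivFunOnFinite.symm (w : Fin r → ℕ)) 1) =
        MvPolynomial.monomial (σ w) 1 := by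
      intro w
      have := (MvPolynomial.basisMonomials (Fin r) F).constr_basis F (fun u =>
        if h : (u : Fin r → ℕ) ∈ Γ then MvPolynomial.monomial (σ ⟨u, h⟩) (1 : F) else 0)
        (Finsupp.equivFunOnFinite.symm (w : Fin r → ℕ))
      rw [MvPolynomial.coe_basisMonomials] at this
      exact this.trans (dif_pos w.2)
    have key : ∀ f : MvPolynomial (Fin s) F, f - L (toricMap F γ f) ∈ toricIdeal F γ := by
      intro f
      induction f using MvPolynomial.induction_on' with
      | monomial α a =>
        have h1 : MvPolynomial.monomial α a = a • MvPolynomial.monomial α (1 : F) := by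
          simp [MvPolynomial.smul_monomial]
        rw [h1, map_smul, SetLike.val_smul, map_smul, ← smul_sub, coe_toricMap_monomial, hL]
        refine Submodule.smul_of_tower_mem _ a (Ideal.subset_span ⟨α, _, ?_, rfl⟩)
        rw [hσ]
      | add f g hf hg =>
        rw [map_add, AddMemClass.coe_add, map_add, add_sub_add_comm]
        exact Ideal.add_mem _ hf hg
    intro f hf
    have := key f
    rw [RingHom.mem_ker] at hf
    rwa [hf, ZeroMemClass.coe_zero, map_zero, sub_zero] at this
  · refine Ideal.span_le.mpr ?_
    rintro _ ⟨α, β, hαβ, rfl⟩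
    rw [SetLike.mem_coe, RingHom.mem_ker, map_sub, sub_eq_zero]
    exact Subtype.ext (by rw [coe_toricMap_monomial, coe_toricMap_monomial, hαβ])

end Toric

/-! ### Gordan's alternative and weights in `ℕ` -/

section Gordan

/-- **Gordan's alternative**: finitely many vectors without a nontrivial nonnegative linear relation
lie in an open half-space. -/
theorem exists_dual_forall_pos {K : Type*} [Field K] [LinearOrder K] [IsStrictOrderedRing K]
    {ι : Type*} (s : Finset ι) : ∀ (V : Type*) [AddCommGroup V] [Module K V] (v : ι → V),
    (∀ c : ι → K, (∀ i ∈ s, 0 ≤ c i) → ∑ i ∈ s, c i • v i = 0 → ∀ i ∈ s, c i = 0) →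
    ∃ f : V →ₗ[K] K, ∀ i ∈ s, 0 < f (v i) := by
  classical
  induction s using Finset.induction_on with
  | empty => exact fun V _ _ v _ => ⟨0, by simp⟩
  | insert a s ha ih =>
    intro V _ _ v H
    have Hs : ∀ c : ι → K, (∀ i ∈ s, 0 ≤ c i) → ∀ b : K, 0 ≤ b →
        ∑ i ∈ s, c i • v i + b • v a = 0 → b = 0 ∧ ∀ i ∈ s, c i = 0 := by
      intro c hc b hb h
      have hne : ∀ i ∈ s, i ≠ a := fun i hi h => ha (h ▸ hi)
      have := H (Function.update c a b) ?_ ?_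
      · refine ⟨by simpa using this a (Finset.mem_insert_self _ _), fun i hi => ?_⟩
        simpa [hne i hi] using this i (Finset.mem_insert_of_mem hi)
      · intro i hi
        rcases Finset.mem_insert.mp hi with rfl | hi
        · simpa using hb
        · simpa [hne i hi] using hc i hi
      · rw [Finset.sum_insert ha, add_comm, Function.update_self, ← h]
        congr 1
        exact Finset.sum_congr rfl fun i hi => by rw [Function.update_of_ne (hne i hi)]
    obtain ⟨f, hf⟩ := ih V v fun c hc h => (Hs c hc 0 le_rfl (by simpa using h)).2
    -- Project along `v a`. If the images still have no nonnegative relation, a functional `g` that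
    -- is positive on them and zero on `v a`, taken with a large factor, is added to a `k` positive
    -- on `v a`. Otherwise a positive multiple of `v a` is a nonnegative combination of the other
    -- vectors, and `f` is already positive on it.
    by_cases Hq : ∀ c : ι → K, (∀ i ∈ s, 0 ≤ c i) →
        ∑ i ∈ s, c i • (K ∙ v a).mkQ (v i) = 0 → ∀ i ∈ s, c i = 0
    · obtain ⟨g, hg⟩ := ih (V ⧸ K ∙ v a) (fun i => (K ∙ v a).mkQ (v i)) Hq
      have hva : v a ≠ 0 := fun h0 => by
        have := (Hs 0 (by simp) 1 zero_le_one (by simp [h0])).1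
        exact one_ne_zero this
      obtain ⟨k, hk⟩ : ∃ k : V →ₗ[K] K, 0 < k (v a) := by
        obtain ⟨k, hk⟩ := not_forall.mp (mt (Module.forall_dual_apply_eq_zero_iff K (v a)).mp hva)
        rcases lt_or_gt_of_ne hk with hk | hk
        · exact ⟨-k, by simpa using hk⟩
        · exact ⟨k, hk⟩
      obtain ⟨N, hN⟩ := Finset.exists_le
        (s.image fun i => -k (v i) / g ((K ∙ v a).mkQ (v i)) + 1)
      refine ⟨k + N • g.comp (K ∙ v a).mkQ, fun i hi => ?_⟩
      rcases Finset.mem_insert.mp hi with rfl | hi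
      · have h0 : (K ∙ v i).mkQ (v i) = 0 := by
          rw [Submodule.mkQ_apply, Submodule.Quotient.mk_eq_zero]
          exact Submodule.mem_span_singleton_self _
        rw [LinearMap.add_apply, LinearMap.smul_apply, LinearMap.comp_apply, h0]
        simpa using hk
      · have h1 := hN _ (Finset.mem_image_of_mem _ hi)
        have h2 := hg i hi
        have h3 : -k (v i) / g ((K ∙ v a).mkQ (v i)) < N := by linarith
        rw [div_lt_iff₀ h2] at h3
        rw [LinearMap.add_apply, LinearMap.smul_apply, LinearMap.comp_apply, smul_eq_mul]
        linarith
    · push Not at Hq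
      obtain ⟨c, hc, hsum, j, hj, hcj⟩ := Hq
      have hmem : ∑ i ∈ s, c i • v i ∈ K ∙ v a := by
        rw [← Submodule.Quotient.mk_eq_zero, ← Submodule.mkQ_apply, map_sum]
        simpa using hsum
      obtain ⟨b, hb⟩ := Submodule.mem_span_singleton.mp hmem
      -- If `b ≤ 0`, moving `b • v a` to the other side would give a nontrivial nonnegative
      -- relation.
      have hb0 : 0 < b := by
        by_contra hb'
        refine hcj ((Hs c hc (-b) (by linarith) ?_).2 j hj)
        rw [← hb]
        simp
      refine ⟨f, fun i hi => ?_⟩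
      rcases Finset.mem_insert.mp hi with rfl | hi
      · have h1 : b * f (v i) = ∑ j ∈ s, c j * f (v j) := by
          have := congrArg f hb
          simpa using this
        have h2 : 0 < ∑ j ∈ s, c j * f (v j) :=
          Finset.sum_pos' (fun i hi => mul_nonneg (hc i hi) (hf i hi).le)
            ⟨j, hj, mul_pos (lt_of_le_of_ne (hc j hj) (Ne.symm hcj)) (hf j hj)⟩
        rw [← h1] at h2
        exact (mul_pos_iff_of_pos_left hb0).mp h2
      · exact hf i hi

theorem exists_nat_mul_eq_intCast {ι : Type*} (s : Finset ι) (c : ι → ℚ) :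
    ∃ N : ℕ, 0 < N ∧ ∀ i ∈ s, ∃ z : ℤ, (N : ℚ) * c i = z := by
  refine ⟨∏ i ∈ s, (c i).den, Finset.prod_pos fun i _ => (c i).den_pos, fun i hi => ?_⟩
  obtain ⟨k, hk⟩ := Finset.dvd_prod_of_mem (fun i => (c i).den) hi
  refine ⟨k * (c i).num, ?_⟩
  rw [hk]
  push_cast
  rw [mul_comm ((c i).den : ℚ), mul_assoc, Rat.den_mul_eq_num]

/-- Finitely many strict inequalities in a well-ordered finitely generated semigroup are preserved
by an additive map to `ℕ`. -/
theorem exists_addMonoidHom_nat_forall_lt {S : Type*} [AddCommMonoid S] [LinearOrder S]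
    (hS : IsWellOrderedSemigroup S) {r : ℕ} (emb : S →+ (Fin r → ℕ))
    (hemb : Function.Injective emb) {s : ℕ} {γ : Fin s → S}
    (hγ : AddSubmonoid.closure (Set.range γ) = ⊤) (T : Finset (S × S)) (hT : ∀ p ∈ T, p.1 < p.2) :
    ∃ l : S →+ ℕ, ∀ p ∈ T, l p.1 < l p.2 := by
  classical
  have := hS.isOrderedCancelAddMonoid
  -- The extra inequalities `0 < γ i` make the functional nonnegative on the generators, hence on
  -- all of `S`.
  let T' : Finset (S × S) := T ∪ ((Finset.univ.image fun i => ((0 : S), γ i)).filter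
    fun p => p.1 < p.2)
  have hT' : ∀ p ∈ T', p.1 < p.2 := by
    intro p hp
    rcases Finset.mem_union.mp hp with hp | hp
    · exact hT p hp
    · exact (Finset.mem_filter.mp hp).2
  let q : S →+ (Fin r → ℚ) :=
    { toFun := fun w j => (emb w j : ℚ)
      map_zero' := by ext; simp
      map_add' := fun a b => by ext; simp }
  have hq : Function.Injective q := by
    intro a b hab
    refine hemb (funext fun j => ?_)
    exact Nat.cast_injective (congrFun hab j)
  obtain ⟨f, hf⟩ := exists_dual_forall_pos (K := ℚ) T' (Fin r → ℚ) (fun p => q p.2 - q p.1) (by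
    intro c hc hsum
    obtain ⟨N, hN, hNc⟩ := exists_nat_mul_eq_intCast T' c
    have : ∀ p ∈ T', ∃ n : ℕ, (N : ℚ) * c p = n := by
      intro p hp
      obtain ⟨z, hz⟩ := hNc p hp
      have hz0 : 0 ≤ z := by
        have : (0 : ℚ) ≤ z := by rw [← hz]; exact mul_nonneg (Nat.cast_nonneg N) (hc p hp)
        exact_mod_cast this
      obtain ⟨n, rfl⟩ := Int.eq_ofNat_of_zero_le hz0
      exact ⟨n, by simpa using hz⟩
    choose! n hn using this
    -- With denominators cleared, a nonnegative relation between the differences is an equality in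
    -- `S`; strict monotonicity of addition rules it out unless all `n p` vanish.
    have hrel : ∑ p ∈ T', n p • p.2 = ∑ p ∈ T', n p • p.1 := by
      apply hq
      rw [← sub_eq_zero, map_sum, map_sum, ← Finset.sum_sub_distrib]
      have h1 : (N : ℚ) • ∑ p ∈ T', c p • (q p.2 - q p.1) = 0 := by rw [hsum, smul_zero]
      rw [← h1, Finset.smul_sum]
      refine Finset.sum_congr rfl fun p hp => ?_
      rw [map_nsmul, map_nsmul, ← nsmul_sub, smul_smul, hn p hp, Nat.cast_smul_eq_nsmul]
    intro p hp
    by_contra hcp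
    have hnp : n p ≠ 0 := by
      intro h0
      have := hn p hp
      rw [h0, Nat.cast_zero, mul_eq_zero] at this
      rcases this with h | h
      · exact hN.ne' (by exact_mod_cast h)
      · exact hcp h
    refine absurd hrel.symm (Finset.sum_lt_sum (fun p hp => ?_) ⟨p, hp, ?_⟩).ne
    · exact nsmul_le_nsmul_right (hT' p hp).le _
    · exact nsmul_lt_nsmul_right hnp (hT' p hp))
  obtain ⟨N, hN, hNz⟩ := exists_nat_mul_eq_intCast Finset.univ fun j => f (Pi.single j 1)
  choose z hz using fun j => hNz j (Finset.mem_univ j)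
  let l : S →+ ℤ :=
    { toFun := fun w => ∑ j, (emb w j : ℤ) * z j
      map_zero' := by simp
      map_add' := fun a b => by simp [add_mul, Finset.sum_add_distrib] }
  have hl : ∀ w, (l w : ℚ) = N * f (q w) := by
    intro w
    have h1 : q w = ∑ j, (emb w j : ℚ) • Pi.single j (1 : ℚ) := by
      ext k
      simp [q, Finset.sum_apply, Pi.single_apply]
    rw [h1, map_sum, Finset.mul_sum]
    change ((∑ j, (emb w j : ℤ) * z j : ℤ) : ℚ) = _
    push_cast
    refine Finset.sum_congr rfl fun j _ => ?_
    rw [← hz j, map_smul, smul_eq_mul]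
    ring
  have hlt : ∀ p ∈ T', l p.1 < l p.2 := by
    intro p hp
    have h1 : (0 : ℚ) < f (q p.2) - f (q p.1) := by rw [← map_sub]; exact hf p hp
    have h2 : (l p.1 : ℚ) < l p.2 := by
      rw [hl, hl]
      exact mul_lt_mul_of_pos_left (by linarith) (by exact_mod_cast hN)
    exact_mod_cast h2
  have hnonneg : ∀ w, 0 ≤ l w := by
    intro w
    have hw : w ∈ AddSubmonoid.closure (Set.range γ) := by rw [hγ]; trivial
    induction hw using AddSubmonoid.closure_induction with
    | mem x hx =>
      obtain ⟨i, rfl⟩ := hx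
      rcases (hS.zero_le (γ i)).eq_or_lt with h0 | h0
      · rw [← h0, map_zero]
      · have := hlt (0, γ i) (Finset.mem_union_right _ (Finset.mem_filter.mpr
          ⟨Finset.mem_image_of_mem _ (Finset.mem_univ i), h0⟩))
        rw [map_zero] at this
        exact this.le
    | zero => rw [map_zero]
    | add a b _ _ ha hb => rw [map_add]; exact add_nonneg ha hb
  refine ⟨{ toFun := fun w => (l w).toNat
            map_zero' := by simp
            map_add' := fun a b => by
              rw [map_add, Int.toNat_add (hnonneg a) (hnonneg b)] }, fun p hp => ?_⟩
  have h1 := hlt p (Finset.mem_union_left _ hp)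
  have h2 := hnonneg p.1
  change (l p.1).toNat < (l p.2).toNat
  omega

end Gordan

/-! ### Extending a character from the relation lattice -/

section Character

/-- A function on the pairs of exponents of equal weight which is additive is given by an additive
function of the exponents. -/
theorem exists_eq_sum_sub_sum_of_additive {S : Type*} [AddCommMonoid S] {r : ℕ}
    (emb : S →+ (Fin r → ℕ)) (hemb : Function.Injective emb) {s : ℕ} (γ : Fin s → S)
    {A : Type*} [AddCommGroup A] (c : (Fin s →₀ ℕ) → (Fin s →₀ ℕ) → A)
    (hc0 : ∀ α, c α α = 0)
    (hc : ∀ α β α' β', monWeight γ α = monWeight γ β → monWeight γ α' = monWeight γ β' →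
      c (α + α') (β + β') = c α β + c α' β') :
    ∃ u : Fin s → A, ∀ α β, monWeight γ α = monWeight γ β →
      c α β = ∑ i, α i • u i - ∑ i, β i • u i := by
  let M : (Fin s → ℤ) →ₗ[ℤ] (Fin r → ℤ) :=
    Fintype.linearCombination ℤ fun i j => (emb (γ i) j : ℤ)
  let cast : (Fin s →₀ ℕ) →+ (Fin s → ℤ) :=
    { toFun := fun α i => (α i : ℤ)
      map_zero' := by ext; simp
      map_add' := fun a b => by ext; simp }
  have hM : ∀ α, M (cast α) = fun j => (emb (monWeight γ α) j : ℤ) := by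
    intro α
    ext j
    simp [M, cast, Fintype.linearCombination_apply, monWeight, Finsupp.weight_apply,
      Finsupp.sum_fintype, Finset.sum_apply]
  have hMinj : ∀ α β, monWeight γ α = monWeight γ β ↔ M (cast α) = M (cast β) := by
    intro α β
    rw [hM, hM]
    constructor
    · intro h; rw [h]
    · intro h
      refine hemb (funext fun j => ?_)
      exact Nat.cast_injective (congrFun h j)
  let pos : (Fin s → ℤ) → (Fin s →₀ ℕ) := fun v =>
    Finsupp.equivFunOnFinite.symm fun i => (v i).toNat
  have hpos : ∀ v, cast (pos v) - cast (pos (-v)) = v := by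
    intro v
    ext i
    simp [cast, pos]
  -- Removing the common part `α ⊓ β` shows that `c α β` depends only on the difference of the
  -- exponents, so `c` descends to the lattice `ker M`.
  have hwd : ∀ α β, monWeight γ α = monWeight γ β →
      c α β = c (pos (cast α - cast β)) (pos (-(cast α - cast β))) := by
    intro α β hαβ
    have h1 : pos (cast α - cast β) + (α ⊓ β) = α := by
      ext i
      simp [pos, cast]
    have h2 : pos (-(cast α - cast β)) + (α ⊓ β) = β := by
      ext i
      simp [pos, cast]
      omega
    have h3 := hc (pos (cast α - cast β)) (pos (-(cast α - cast β))) (α ⊓ β) (α ⊓ β) ?_ rfl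
    · rwa [h1, h2, hc0, add_zero] at h3
    · rw [hMinj, ← sub_eq_zero, ← map_sub, hpos, map_sub, sub_eq_zero, ← hMinj]
      exact hαβ
  have hker : ∀ v ∈ LinearMap.ker M, monWeight γ (pos v) = monWeight γ (pos (-v)) := by
    intro v hv
    rw [hMinj, ← sub_eq_zero, ← map_sub, hpos]
    exact hv
  let χ : LinearMap.ker M →+ A := AddMonoidHom.mk' (fun v => c (pos v) (pos (-v))) (by
    rintro ⟨v, hv⟩ ⟨w, hw⟩
    have h1 := hc _ _ _ _ (hker v hv) (hker w hw)
    have h2 := hwd (pos v + pos w) (pos (-v) + pos (-w)) (by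
      rw [map_add, map_add, hker v hv, hker w hw])
    have h3 : cast (pos v + pos w) - cast (pos (-v) + pos (-w)) = v + w := by
      rw [map_add, map_add, add_sub_add_comm, hpos, hpos]
    rw [h3] at h2
    exact h2.symm.trans h1)
  -- The range of `M` is a subgroup of `ℤ^r`, hence free, so `ker M` is a direct summand of `ℤ^s`.
  -- The character extends along the projection `π`, whatever the group `A`.
  obtain ⟨σ, hσ⟩ := Module.projective_lifting_property M.rangeRestrict LinearMap.id
    M.surjective_rangeRestrict
  have hσ' : ∀ v, M (σ (M.rangeRestrict v)) = M v := fun v =>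
    congrArg Subtype.val (LinearMap.congr_fun hσ (M.rangeRestrict v))
  let π : (Fin s → ℤ) →ₗ[ℤ] LinearMap.ker M :=
    (LinearMap.id - σ.comp M.rangeRestrict).codRestrict _ fun v => by
      rw [LinearMap.mem_ker, LinearMap.sub_apply, map_sub, LinearMap.comp_apply, hσ',
        LinearMap.id_apply, sub_self]
  have hπ : ∀ v (hv : v ∈ LinearMap.ker M), π v = ⟨v, hv⟩ := by
    intro v hv
    refine Subtype.ext ?_
    change v - σ (M.rangeRestrict v) = v
    have : M.rangeRestrict v = 0 := Subtype.ext hv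
    rw [this, map_zero, sub_zero]
  let χ' : (Fin s → ℤ) →+ A := χ.comp π.toAddMonoidHom
  have hχ' : ∀ α, χ' (cast α) = ∑ i, α i • χ' (Pi.single i 1) := by
    intro α
    have : cast α = ∑ i, α i • (Pi.single i 1 : Fin s → ℤ) := by
      ext k
      simp [cast, Finset.sum_apply, Pi.single_apply]
    rw [this, map_sum]
    simp only [map_nsmul]
  refine ⟨fun i => χ' (Pi.single i 1), fun α β hαβ => ?_⟩
  have hmem : cast α - cast β ∈ LinearMap.ker M := by
    rw [LinearMap.mem_ker, map_sub, sub_eq_zero, ← hMinj]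
    exact hαβ
  rw [← hχ', ← hχ', ← map_sub, hwd α β hαβ]
  change _ = χ (π _)
  rw [hπ _ hmem]
  rfl

end Character

/-! ### Normalized generators and an `ℕ`-valued weight -/

section Normalization

variable {F : Type*} [Field F] {R : Type*} [CommRing R] [Algebra F R]
  {S : Type*} [AddCommMonoid S] [LinearOrder S] {ρ : R → WithBot S}
  {s : ℕ} {γ : Fin s → S}

theorem MvPolynomial.aeval_monomial_smul (u : Fin s → F) (z : Fin s → R) (α : Fin s →₀ ℕ) :
    aeval (fun i => u i • z i) (monomial α (1 : F)) =
      (∏ i, u i ^ α i) • aeval z (monomial α (1 : F)) := by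
  rw [aeval_monomial, aeval_monomial, map_one, one_mul, one_mul,
    Finsupp.prod_fintype _ _ (by simp), Finsupp.prod_fintype _ _ (by simp)]
  simp only [smul_pow]
  rw [Finset.prod_smul]

theorem MvPolynomial.aeval_monomial_add (z : Fin s → R) (α β : Fin s →₀ ℕ) :
    aeval z (monomial (α + β) (1 : F)) =
      aeval z (monomial α (1 : F)) * aeval z (monomial β (1 : F)) := by
  rw [← map_mul, monomial_mul, one_mul]

theorem IsOrderFunction.eq_zero_of_smul_mem_ltSubmodule (h : IsOrderFunction F ρ) {w : S} {f : R}
    (hf : ρ f = w) {a : F} (ha : a • f ∈ h.ltSubmodule w) : a = 0 := by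
  by_contra ha0
  rw [h.mem_ltSubmodule, h.smul a f ha0, hf] at ha
  exact lt_irrefl _ ha

theorem IsOrderFunction.mul_mem_ltSubmodule (hS : IsWellOrderedSemigroup S)
    (h : IsOrderFunction F ρ) {v w : S} {f g : R} (hf : ρ f = v) (hg : g ∈ h.ltSubmodule w) :
    f * g ∈ h.ltSubmodule (v + w) := by
  have := hS.isOrderedCancelAddMonoid
  rw [h.mem_ltSubmodule] at hg ⊢
  rw [h.mul, hf, WithBot.coe_add]
  exact WithBot.add_lt_add_left WithBot.coe_ne_bot hg

/-- There are elements of orders `γ₁, …, γ_s` for which monomials of equal weight have equal leading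
coefficients. -/
theorem IsOrderFunction.exists_normalized (hS : IsWellOrderedSemigroup S)
    (h : IsOrderFunction F ρ) {r : ℕ} (emb : S →+ (Fin r → ℕ)) (hemb : Function.Injective emb)
    (γ : Fin s → S) :
    ∃ x : Fin s → R, (∀ i, ρ (x i) = γ i) ∧ ∀ α β, monWeight γ α = monWeight γ β →
      MvPolynomial.aeval x (MvPolynomial.monomial α (1 : F)) -
        MvPolynomial.aeval x (MvPolynomial.monomial β (1 : F)) ∈
          h.ltSubmodule (monWeight γ α) := by
  choose z hz using fun i => h.surjective (γ i)
  set Z : (Fin s →₀ ℕ) → R := fun α => MvPolynomial.aeval z (MvPolynomial.monomial α (1 : F))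
  have hZ : ∀ α, ρ (Z α) = monWeight γ α := h.map_aeval_monomial hS hz
  have hZadd : ∀ α β, Z (α + β) = Z α * Z β := MvPolynomial.aeval_monomial_add z
  have hex : ∀ α β, ∃ c : Fˣ, monWeight γ α = monWeight γ β →
      Z α - (c : F) • Z β ∈ h.ltSubmodule (monWeight γ α) := by
    intro α β
    by_cases hαβ : monWeight γ α = monWeight γ β
    · obtain ⟨c, hc, hlt⟩ := h.exists_sub_lt (Z α) (Z β) (by rw [hZ, hZ, hαβ])
        (by rw [hZ]; exact WithBot.coe_ne_bot)
      rw [hZ α] at hlt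
      exact ⟨Units.mk0 c hc, fun _ => hlt⟩
    · exact ⟨1, fun h => absurd h hαβ⟩
  choose c hc using hex
  -- The ratio of leading coefficients is unique; its multiplicativity follows by exhibiting the
  -- product as another candidate.
  have huniq : ∀ α β (a : Fˣ), monWeight γ α = monWeight γ β →
      Z α - (a : F) • Z β ∈ h.ltSubmodule (monWeight γ α) → c α β = a := by
    intro α β a hαβ ha
    have h1 := Submodule.sub_mem _ ha (hc α β hαβ)
    rw [sub_sub_sub_cancel_left, ← sub_smul, hαβ] at h1
    exact Units.ext (sub_eq_zero.mp (h.eq_zero_of_smul_mem_ltSubmodule (hZ β) h1))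
  obtain ⟨u, hu⟩ := exists_eq_sum_sub_sum_of_additive emb hemb γ
    (fun α β => Additive.ofMul (c α β))
    (fun α => by
      rw [huniq α α 1 rfl (by simp)]
      rfl)
    (fun α β α' β' hαβ hαβ' => by
      rw [← ofMul_mul]
      congr 1
      refine huniq _ _ _ (by rw [map_add, map_add, hαβ, hαβ']) ?_
      have h1 : Z (α + α') - ((c α β * c α' β' : Fˣ) : F) • Z (β + β') =
          Z α * (Z α' - (c α' β' : F) • Z β') +
            (c α' β' : F) • (Z β' * (Z α - (c α β : F) • Z β)) := by
        rw [hZadd, hZadd, Units.val_mul]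
        simp only [Algebra.smul_def, map_mul]
        ring
      rw [h1, map_add]
      refine Submodule.add_mem _ (h.mul_mem_ltSubmodule hS (hZ α) (hc α' β' hαβ')) ?_
      rw [hαβ', add_comm]
      exact Submodule.smul_mem _ _ (h.mul_mem_ltSubmodule hS (hZ β') (hc α β hαβ)))
  let v : Fin s → Fˣ := fun i => (u i).toMul
  have hv : ∀ α β, monWeight γ α = monWeight γ β →
      c α β = (∏ i, v i ^ α i) / ∏ i, v i ^ β i := hu
  -- Since `c α β = v^α / v^β`, dividing `z i` by `v i` turns every ratio into `1`.
  refine ⟨fun i => ((v i)⁻¹ : F) • z i, fun i => ?_, fun α β hαβ => ?_⟩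
  · rw [h.smul _ _ (by simp), hz]
  · rw [MvPolynomial.aeval_monomial_smul, MvPolynomial.aeval_monomial_smul]
    have h1 := Submodule.smul_mem _ (∏ i, ((v i)⁻¹ : F) ^ α i) (hc α β hαβ)
    rw [smul_sub, smul_smul, hv α β hαβ] at h1
    convert h1 using 3
    rw [Units.val_div_eq_div_val, Units.coe_prod, Units.coe_prod]
    simp only [inv_pow, Finset.prod_inv_distrib, Units.val_pow_eq_pow_val]
    rw [div_eq_mul_inv, inv_mul_cancel_left₀]
    exact Finset.prod_ne_zero_iff.mpr fun i _ => pow_ne_zero _ (v i).ne_zero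

/-- In a nontrivial relation, the term of largest order would be a sum of terms of smaller order. -/
theorem IsOrderFunction.linearIndependent_of_eq_coe (h : IsOrderFunction F ρ) {y : S → R}
    (hy : ∀ w, ρ (y w) = w) : LinearIndependent F y := by
  classical
  rw [linearIndependent_iff']
  intro t a hsum
  by_contra! hne
  obtain ⟨w, hw, hmax⟩ := (t.filter fun w => a w ≠ 0).exists_max_image id
    (by obtain ⟨w, hw, hw0⟩ := hne; exact ⟨w, Finset.mem_filter.mpr ⟨hw, hw0⟩⟩)
  obtain ⟨hwt, hw0⟩ := Finset.mem_filter.mp hw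
  rw [← Finset.add_sum_erase _ _ hwt, add_eq_zero_iff_eq_neg] at hsum
  refine hw0 (h.eq_zero_of_smul_mem_ltSubmodule (hy w) ?_)
  rw [hsum]
  refine Submodule.neg_mem _ (Submodule.sum_mem _ fun v hv => ?_)
  obtain ⟨hvw, hvt⟩ := Finset.mem_erase.mp hv
  by_cases hv0 : a v = 0
  · rw [hv0, zero_smul]; exact Submodule.zero_mem _
  · refine Submodule.smul_mem _ _ ?_
    rw [h.mem_ltSubmodule, hy, WithBot.coe_lt_coe]
    exact lt_of_le_of_ne (hmax v (Finset.mem_filter.mpr ⟨hvt, hv0⟩)) hvw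

/-- An `ℕ`-valued weight for which all leading forms of relations between suitable generators of an
order domain are binomials. -/
theorem IsOrderFunction.exists_natWeight (hS : IsWellOrderedSemigroup S)
    (h : IsOrderFunction F ρ) {r : ℕ} (emb : S →+ (Fin r → ℕ)) (hemb : Function.Injective emb)
    (hγ : AddSubmonoid.closure (Set.range γ) = ⊤) :
    ∃ (x : Fin s → R) (l : S →+ ℕ) (σ : S → Fin s →₀ ℕ), (∀ w, monWeight γ (σ w) = w) ∧
      LinearIndependent F (fun w => MvPolynomial.aeval x (MvPolynomial.monomial (σ w) (1 : F))) ∧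
      Function.Surjective (MvPolynomial.aeval x : MvPolynomial (Fin s) F →ₐ[F] R) ∧
      ∀ α, ∃ f : MvPolynomial (Fin s) F, MvPolynomial.aeval x f =
        MvPolynomial.aeval x (MvPolynomial.monomial α (1 : F)) -
          MvPolynomial.aeval x (MvPolynomial.monomial (σ (monWeight γ α)) (1 : F)) ∧
        ∀ η ∈ f.support, l (monWeight γ η) < l (monWeight γ α) := by
  classical
  obtain ⟨x, hx, hxn⟩ := h.exists_normalized hS emb hemb γ
  have hI := h.isGeilPellikaanForm_ker hS hγ hx MonomialOrder.lex
  set m := weightOrder hS γ MonomialOrder.lex with hm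
  set I := RingHom.ker (MvPolynomial.aeval x : MvPolynomial (Fin s) F →ₐ[F] R) with hIdef
  have hstd : ∀ w, ∃ δ ∈ standardMonomials m I, monWeight γ δ = w := by
    intro w
    obtain ⟨α, rfl⟩ := monWeight_surjective hγ w
    obtain ⟨δ, c, hδ, htop⟩ := hI.exists_hasStandardTop_monomial α (a := (1 : F)) one_ne_zero
    exact ⟨δ, htop.standard, hδ⟩
  choose σ hσstd hσ using hstd
  obtain ⟨⟨G, hG, h2⟩, hinj⟩ := hI
  -- Only the finitely many inequalities between a lower term and the top of a Gröbner basis element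
  -- are imposed on `l`; by additivity they propagate through all reductions.
  obtain ⟨l, hl⟩ := exists_addMonoidHom_nat_forall_lt hS emb hemb hγ
    ((G.biUnion fun g => g.support.image fun η =>
      (monWeight γ η, monWeight γ (m.degree g))).filter fun p => p.1 < p.2)
    (fun p hp => (Finset.mem_filter.mp hp).2)
  have hlG : ∀ g ∈ G, ∀ η ∈ g.support, monWeight γ η < monWeight γ (m.degree g) →
      l (monWeight γ η) < l (monWeight γ (m.degree g)) := fun g hg η hη hlt =>
    hl (monWeight γ η, monWeight γ (m.degree g)) (Finset.mem_filter.mpr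
      ⟨Finset.mem_biUnion.mpr ⟨g, hg, Finset.mem_image_of_mem _ hη⟩, hlt⟩)
  refine ⟨x, l, σ, hσ, h.linearIndependent_of_eq_coe fun w => ?_, fun y => ?_, ?_⟩
  · rw [h.map_aeval_monomial hS hx, hσ]
  · obtain ⟨f, hf, -⟩ := h.exists_aeval_eq hS hγ hx y
    exact ⟨f, hf⟩
  intro α
  have hwf := m.wellFoundedLT_syn
  induction hα : m.toSyn α using WellFoundedLT.induction generalizing α with
  | _ v ih =>
  subst hα
  by_cases hst : α ∈ standardMonomials m I
  · have : σ (monWeight γ α) = α := hinj (hσstd _) hst (hσ _)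
    exact ⟨0, by rw [this, _root_.map_zero, sub_self], by simp⟩
  · obtain ⟨f, hf, hf0, rfl⟩ := not_not.mp hst
    obtain ⟨g, hg, hle⟩ := hG.exists_degree_le f hf hf0
    obtain ⟨ν, c, hc, hνw, hνlt, k, hk, hgeq⟩ :=
      exists_eq_monomial_add_of_ncard_eq_two hS (hG.monic g hg) (h2 g hg)
    rw [← hm] at hνw hνlt hk hgeq
    set η := m.degree f - m.degree g
    have hη : m.degree f = η + m.degree g := (tsub_add_cancel_of_le hle).symm
    have hw : monWeight γ (η + ν) = monWeight γ (m.degree f) := by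
      rw [hη, map_add, map_add, hνw]
    obtain ⟨f', hf', hf'l⟩ := ih (m.toSyn (η + ν)) (by rw [hη, map_add, map_add]; gcongr)
      (η + ν) rfl
    have hg0 : MvPolynomial.aeval x (MvPolynomial.monomial (m.degree g) (1 : F)) +
        c • MvPolynomial.aeval x (MvPolynomial.monomial ν (1 : F)) +
        MvPolynomial.aeval x k = 0 := by
      have h1 : MvPolynomial.aeval x g = 0 := hG.mem g hg
      have h2 : MvPolynomial.monomial ν c = c • MvPolynomial.monomial ν (1 : F) := by
        simp [MvPolynomial.smul_monomial]
      rw [hgeq, map_add, map_add, h2, map_smul] at h1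
      exact h1
    -- By normalization the two top monomials have equal leading coefficients, so the binomial must
    -- be a difference.
    have hc1 : c + 1 = 0 := by
      refine h.eq_zero_of_smul_mem_ltSubmodule (h.map_aeval_monomial hS hx ν) ?_
      have h1 : (c + 1) • MvPolynomial.aeval x (MvPolynomial.monomial ν (1 : F)) =
          -((MvPolynomial.aeval x (MvPolynomial.monomial (m.degree g) (1 : F)) -
            MvPolynomial.aeval x (MvPolynomial.monomial ν (1 : F))) + MvPolynomial.aeval x k) := by
        rw [add_smul, one_smul, ← sub_eq_zero, ← hg0]
        ring
      rw [h1, hνw]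
      exact Submodule.neg_mem _ (Submodule.add_mem _ (hxn _ _ hνw.symm)
        (h.aeval_mem_ltSubmodule hS hx hk))
    rw [eq_neg_of_add_eq_zero_left hc1, neg_one_smul] at hg0
    -- In `R` one reduction step changes `x^(η + deg g)` into `x^(η + ν) - x^η k(x)`, and `f'`
    -- accounts for the remaining steps from `η + ν`.
    refine ⟨f' - MvPolynomial.monomial η 1 * k, ?_, ?_⟩
    · rw [map_sub, hf', map_mul, hw]
      rw [MvPolynomial.aeval_monomial_add, hη, MvPolynomial.aeval_monomial_add]
      linear_combination -(MvPolynomial.aeval x (MvPolynomial.monomial η (1 : F))) * hg0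
    · intro κ hκ
      rcases Finset.mem_union.mp (MvPolynomial.support_sub _ _ _ hκ) with hκ | hκ
      · rw [← hw]; exact hf'l κ hκ
      · obtain ⟨a, ha, b, hb, rfl⟩ := Finset.mem_add.mp (MvPolynomial.support_mul _ _ hκ)
        rw [Finset.mem_singleton.mp (MvPolynomial.support_monomial_subset ha), hη, map_add,
          map_add, map_add, map_add]
        refine Nat.add_lt_add_left (hlG g hg b ?_ (mem_weightLT.mp hk b hb)) _
        have hblt := mem_weightLT.mp hk b hb
        rw [MvPolynomial.mem_support_iff, hgeq, MvPolynomial.coeff_add, MvPolynomial.coeff_add,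
          MvPolynomial.coeff_monomial, MvPolynomial.coeff_monomial, if_neg, if_neg, zero_add,
          zero_add]
        · exact MvPolynomial.mem_support_iff.mp hb
        · rintro rfl
          exact hblt.ne hνw
        · intro h1
          exact hblt.ne (by rw [h1])

end Normalization

/-! ### The Rees algebra: flatness and the general fibre -/

section ReesAlgebra

variable {F : Type*} [Field F] {R : Type*} [CommRing R] [Algebra F R] {s : ℕ}

/-- The homomorphism `F[t][X₁, …, X_s] → F[t, t⁻¹] ⊗ R`, `X_i ↦ t^{n_i} x_i`. Its image is the Rees
algebra of the filtration of `R` in which `x_i` has degree `n_i`. -/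
noncomputable def reesMap (F : Type*) [Field F] [Algebra F R] (x : Fin s → R) (n : Fin s → ℕ) :
    MvPolynomial (Fin s) (Polynomial F) →ₐ[Polynomial F] F[T;T⁻¹] ⊗[F] R :=
  MvPolynomial.aeval fun i => LaurentPolynomial.T (n i : ℤ) ⊗ₜ x i

theorem reesMap_monomial (x : Fin s → R) (n : Fin s → ℕ) (α : Fin s →₀ ℕ) (p : Polynomial F) :
    reesMap F x n (MvPolynomial.monomial α p) =
      (Polynomial.toLaurent p * LaurentPolynomial.T (Finsupp.weight n α : ℤ)) ⊗ₜ
        MvPolynomial.aeval x (MvPolynomial.monomial α (1 : F)) := by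
  have h1 : reesMap F x n (MvPolynomial.monomial α 1) =
      LaurentPolynomial.T (Finsupp.weight n α : ℤ) ⊗ₜ
        MvPolynomial.aeval x (MvPolynomial.monomial α (1 : F)) := by
    induction α using Finsupp.induction_linear with
    | zero => simp [Algebra.TensorProduct.one_def]
    | add a b ha hb =>
      have hab : MvPolynomial.monomial (a + b) (1 : Polynomial F) =
        MvPolynomial.monomial a 1 * MvPolynomial.monomial b 1 := by
          simp [MvPolynomial.monomial_mul]
      rw [hab, map_mul, ha, hb, Algebra.TensorProduct.tmul_mul_tmul,
        MvPolynomial.aeval_monomial_add, map_add, Nat.cast_add, LaurentPolynomial.T_add]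
    | single i k =>
      rw [reesMap, MvPolynomial.aeval_monomial, map_one, one_mul,
        Finsupp.prod_single_index (by simp), Algebra.TensorProduct.tmul_pow,
        LaurentPolynomial.T_pow, MvPolynomial.aeval_monomial, map_one, one_mul,
        Finsupp.prod_single_index (by simp)]
      simp [Finsupp.weight_single]
  have h2 : MvPolynomial.monomial α p = p • MvPolynomial.monomial α (1 : Polynomial F) := by
    simp [MvPolynomial.smul_monomial]
  rw [h2, map_smul, h1, TensorProduct.smul_tmul', Algebra.smul_def,
    LaurentPolynomial.algebraMap_eq_toLaurent]

/-- The quotient embeds in the flat module `F[T;T⁻¹] ⊗ R`, so it is torsion-free, which over the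
principal ideal domain `F[t]` means flat. -/
theorem flat_quotient_ker_reesMap (x : Fin s → R) (n : Fin s → ℕ) :
    Module.Flat (Polynomial F)
      (MvPolynomial (Fin s) (Polynomial F) ⧸ RingHom.ker (reesMap F x n)) := by
  have h1 : Module.Flat (Polynomial F) F[T;T⁻¹] :=
    IsLocalization.flat F[T;T⁻¹] (Submonoid.powers (Polynomial.X : Polynomial F))
  have h2 : Module.Flat (Polynomial F) (F[T;T⁻¹] ⊗[F] R) :=
    Module.Flat.trans (Polynomial F) F[T;T⁻¹] _
  have h3 : Module.IsTorsionFree (Polynomial F)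
      (MvPolynomial (Fin s) (Polynomial F) ⧸ RingHom.ker (reesMap F x n)) :=
    (Ideal.kerLiftAlg_injective (reesMap F x n)).moduleIsTorsionFree _ fun c y => map_smul _ c y
  infer_instance

/-- Surjectivity: `x i` is recovered as `T^{-n_i}` times the generator `T^{n_i} x_i`. Injectivity: a
power of `T` clears denominators, and the quotient itself embeds. -/
theorem nonempty_algEquiv_laurent_quotient_ker_reesMap {x : Fin s → R}
    (hx : Function.Surjective (MvPolynomial.aeval x : MvPolynomial (Fin s) F →ₐ[F] R))
    (n : Fin s → ℕ) :
    Nonempty (F[T;T⁻¹] ⊗[Polynomial F]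
      (MvPolynomial (Fin s) (Polynomial F) ⧸ RingHom.ker (reesMap F x n)) ≃ₐ[F[T;T⁻¹]]
        F[T;T⁻¹] ⊗[F] R) := by
  set A := MvPolynomial (Fin s) (Polynomial F) ⧸ RingHom.ker (reesMap F x n)
  let Ψ : F[T;T⁻¹] ⊗[Polynomial F] A →ₐ[F[T;T⁻¹]] F[T;T⁻¹] ⊗[F] R :=
    Algebra.TensorProduct.lift (Algebra.ofId F[T;T⁻¹] _) (Ideal.kerLiftAlg (reesMap F x n))
      fun _ _ => Commute.all _ _
  have hΨ : ∀ (f : F[T;T⁻¹]) (a : A), Ψ (f ⊗ₜ a) = f • Ideal.kerLiftAlg (reesMap F x n) a := by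
    intro f a
    rw [Algebra.TensorProduct.lift_tmul, Algebra.ofId_apply]
    exact (Algebra.smul_def f _).symm
  have hT : ∀ k : ℤ, (LaurentPolynomial.T (-k) : F[T;T⁻¹]) * LaurentPolynomial.T k = 1 := by
    intro k
    rw [← LaurentPolynomial.T_add, neg_add_cancel, LaurentPolynomial.T_zero]
  refine ⟨AlgEquiv.ofBijective Ψ ⟨?_, ?_⟩⟩
  · have hden : ∀ z : F[T;T⁻¹] ⊗[Polynomial F] A, ∃ (k : ℕ) (a : A),
        (LaurentPolynomial.T (k : ℤ) : F[T;T⁻¹]) • z = 1 ⊗ₜ a := by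
      intro z
      induction z using TensorProduct.induction_on with
      | zero => exact ⟨0, 0, by simp⟩
      | tmul f a =>
        obtain ⟨k, p, hp⟩ := LaurentPolynomial.exists_T_pow f
        refine ⟨k, p • a, ?_⟩
        rw [TensorProduct.smul_tmul', smul_eq_mul, mul_comm, ← hp, ← TensorProduct.smul_tmul,
          Algebra.smul_def, mul_one, LaurentPolynomial.algebraMap_eq_toLaurent]
      | add z z' hz hz' =>
        obtain ⟨k, a, ha⟩ := hz
        obtain ⟨k', a', ha'⟩ := hz'
        refine ⟨k + k', (Polynomial.X ^ k' : Polynomial F) • a +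
          (Polynomial.X ^ k : Polynomial F) • a', ?_⟩
        rw [TensorProduct.tmul_add, ← TensorProduct.smul_tmul, ← TensorProduct.smul_tmul,
          Algebra.smul_def, Algebra.smul_def, LaurentPolynomial.algebraMap_X_pow,
          LaurentPolynomial.algebraMap_X_pow, ← smul_eq_mul, ← smul_eq_mul,
          ← TensorProduct.smul_tmul', ← TensorProduct.smul_tmul', ← ha, ← ha', smul_smul,
          smul_smul, ← LaurentPolynomial.T_add, ← LaurentPolynomial.T_add, smul_add,
          Nat.cast_add, add_comm (k' : ℤ)]
    rw [injective_iff_map_eq_zero]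
    intro z hz
    obtain ⟨k, a, ha⟩ := hden z
    have h1 := congrArg Ψ ha
    rw [map_smul, hz, smul_zero, hΨ, one_smul] at h1
    have h2 : a = 0 := Ideal.kerLiftAlg_injective (reesMap F x n) (by rw [← h1, map_zero])
    rw [h2, TensorProduct.tmul_zero] at ha
    rw [← one_smul F[T;T⁻¹] z, ← hT k, mul_smul, ha, smul_zero]
  · have h1 : ∀ y : R, 1 ⊗ₜ y ∈ Ψ.range := by
      have h2 : (MvPolynomial.aeval x : MvPolynomial (Fin s) F →ₐ[F] R).range ≤
          (Ψ.range.restrictScalars F).comap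
            (Algebra.TensorProduct.includeRight : R →ₐ[F] F[T;T⁻¹] ⊗[F] R) := by
        rw [← Algebra.adjoin_range_eq_range_aeval]
        refine Algebra.adjoin_le ?_
        rintro _ ⟨i, rfl⟩
        refine ⟨LaurentPolynomial.T (-(n i : ℤ)) ⊗ₜ Ideal.Quotient.mk _ (MvPolynomial.X i), ?_⟩
        refine (hΨ _ _).trans ?_
        have h3 : Ideal.kerLiftAlg (reesMap F x n) (Ideal.Quotient.mk _ (MvPolynomial.X i)) =
            LaurentPolynomial.T (n i : ℤ) ⊗ₜ x i :=
          (Ideal.kerLiftAlg_mk _ _).trans (MvPolynomial.aeval_X _ i)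
        rw [h3, TensorProduct.smul_tmul', smul_eq_mul, hT]
        rfl
      exact fun y => h2 (hx y)
    intro z
    change z ∈ Ψ.range
    induction z using TensorProduct.induction_on with
    | zero => exact Subalgebra.zero_mem _
    | tmul f y =>
      have : f ⊗ₜ[F] y = f • (1 ⊗ₜ[F] y) := by rw [TensorProduct.smul_tmul', smul_eq_mul, mul_one]
      rw [this]
      exact Subalgebra.smul_mem _ (h1 y) f
    | add a b ha hb => exact Subalgebra.add_mem _ ha hb

theorem sub_map_C_map_eval_mem_span (P : MvPolynomial (Fin s) (Polynomial F)) :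
    P - MvPolynomial.map Polynomial.C (MvPolynomial.map (Polynomial.evalRingHom 0) P) ∈
      Ideal.span {(MvPolynomial.C Polynomial.X : MvPolynomial (Fin s) (Polynomial F))} := by
  induction P using MvPolynomial.induction_on' with
  | monomial α p =>
    rw [MvPolynomial.map_monomial, MvPolynomial.map_monomial, ← map_sub,
      Ideal.mem_span_singleton]
    refine ⟨MvPolynomial.monomial α p.divX, ?_⟩
    rw [MvPolynomial.C_mul_monomial]
    congr 1
    rw [Polynomial.coe_evalRingHom, ← Polynomial.coeff_zero_eq_eval_zero, sub_eq_iff_eq_add]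
    exact p.X_mul_divX_add.symm
  | add p q hp hq =>
    rw [map_add, map_add, add_sub_add_comm]
    exact Ideal.add_mem _ hp hq

end ReesAlgebra

/-! ### The special fibre -/

section Deformation

variable {F : Type*} [Field F] {R : Type*} [CommRing R] [Algebra F R] {r : ℕ}
  {Γ : AddSubmonoid (Fin r → ℕ)} {s : ℕ} {γ : Fin s → Γ} {x : Fin s → R} {l : Γ →+ ℕ}

theorem weight_comp_eq (α : Fin s →₀ ℕ) :
    Finsupp.weight (fun i => l (γ i)) α = l (monWeight γ α) := by
  rw [monWeight, Finsupp.weight_apply, Finsupp.weight_apply, map_finsuppSum]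
  simp

/-- The homomorphism `F[t][X₁, …, X_s] → F[Γ]`, `t ↦ 0`, `X_i ↦ T^{γ_i}`. -/
noncomputable def specialMap (F : Type*) [Field F] (γ : Fin s → Γ) :
    MvPolynomial (Fin s) (Polynomial F) →ₐ[F] toricAlgebra F Γ :=
  (toricMap F γ).comp (MvPolynomial.mapAlgHom (Polynomial.aeval 0))

theorem specialMap_apply (P : MvPolynomial (Fin s) (Polynomial F)) :
    specialMap F γ P = toricMap F γ (MvPolynomial.map (Polynomial.evalRingHom 0) P) := by
  rw [specialMap, AlgHom.comp_apply, MvPolynomial.mapAlgHom_apply]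
  rfl

theorem specialMap_surjective (hγ : AddSubmonoid.closure (Set.range γ) = ⊤) :
    Function.Surjective (specialMap F γ) := by
  intro y
  obtain ⟨f, rfl⟩ := toricMap_surjective hγ y
  refine ⟨MvPolynomial.map Polynomial.C f, ?_⟩
  have h1 : (Polynomial.evalRingHom 0).comp Polynomial.C = RingHom.id F := by
    ext
    simp
  rw [specialMap_apply, MvPolynomial.map_map, h1, MvPolynomial.map_id]

variable {σ : Γ → Fin s →₀ ℕ}

/-- Replacing a monomial by the chosen one of its weight costs only terms of smaller `l`-weight, and
`l` takes values in `ℕ`. -/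
theorem span_range_aeval_monomial_eq_top
    (hx : Function.Surjective (MvPolynomial.aeval x : MvPolynomial (Fin s) F →ₐ[F] R))
    (hred : ∀ α, ∃ f : MvPolynomial (Fin s) F, MvPolynomial.aeval x f =
        MvPolynomial.aeval x (MvPolynomial.monomial α (1 : F)) -
          MvPolynomial.aeval x (MvPolynomial.monomial (σ (monWeight γ α)) (1 : F)) ∧
        ∀ η ∈ f.support, l (monWeight γ η) < l (monWeight γ α)) :
    Submodule.span F (Set.range fun w : Γ =>
      MvPolynomial.aeval x (MvPolynomial.monomial (σ w) (1 : F))) = ⊤ := by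
  set Y := Submodule.span F (Set.range fun w : Γ =>
      MvPolynomial.aeval x (MvPolynomial.monomial (σ w) (1 : F)))
  have hsum : ∀ f : MvPolynomial (Fin s) F, (∀ η ∈ f.support,
      MvPolynomial.aeval x (MvPolynomial.monomial η (1 : F)) ∈ Y) → MvPolynomial.aeval x f ∈ Y := by
    intro f hf
    rw [f.as_sum, map_sum]
    refine Submodule.sum_mem _ fun η hη => ?_
    have h2 : MvPolynomial.monomial η (f.coeff η) =
        f.coeff η • MvPolynomial.monomial η (1 : F) := by simp [MvPolynomial.smul_monomial]
    rw [h2, map_smul]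
    exact Submodule.smul_mem _ _ (hf η hη)
  have hmon : ∀ α, MvPolynomial.aeval x (MvPolynomial.monomial α (1 : F)) ∈ Y := by
    intro α
    induction hk : l (monWeight γ α) using Nat.strong_induction_on generalizing α with
    | _ k ih =>
    obtain ⟨f, hf, hlt⟩ := hred α
    rw [← sub_add_cancel (MvPolynomial.aeval x (MvPolynomial.monomial α (1 : F)))
      (MvPolynomial.aeval x (MvPolynomial.monomial (σ (monWeight γ α)) (1 : F))), ← hf]
    refine Submodule.add_mem _ (hsum f fun η hη => ih _ ?_ η rfl) (Submodule.subset_span ⟨_, rfl⟩)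
    rw [← hk]
    exact hlt η hη
  rw [eq_top_iff]
  intro y _
  obtain ⟨f, rfl⟩ := hx y
  exact hsum f fun η _ => hmon η

/-- The correction terms have `l`-weight strictly below `l w`, so by induction they contribute
nothing to the coordinate at `w`. Without the bound `hle` the coordinate is uncontrolled. -/
theorem coord_aeval_monomial (b : Module.Basis Γ F R)
    (hb : ∀ w, b w = MvPolynomial.aeval x (MvPolynomial.monomial (σ w) (1 : F)))
    (hred : ∀ α, ∃ f : MvPolynomial (Fin s) F, MvPolynomial.aeval x f =
        MvPolynomial.aeval x (MvPolynomial.monomial α (1 : F)) -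
          MvPolynomial.aeval x (MvPolynomial.monomial (σ (monWeight γ α)) (1 : F)) ∧
        ∀ η ∈ f.support, l (monWeight γ η) < l (monWeight γ α))
    (α : Fin s →₀ ℕ) (w : Γ) [Decidable (monWeight γ α = w)] (hle : l (monWeight γ α) ≤ l w) :
    b.coord w (MvPolynomial.aeval x (MvPolynomial.monomial α (1 : F))) =
      if monWeight γ α = w then 1 else 0 := by
  classical
  induction hk : l (monWeight γ α) using Nat.strong_induction_on generalizing α with
  | _ k ih =>
  obtain ⟨f, hf, hlt⟩ := hred α
  have h0 : b.coord w (MvPolynomial.aeval x f) = 0 := by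
    rw [f.as_sum, map_sum, map_sum]
    refine Finset.sum_eq_zero fun η hη => ?_
    have h2 : MvPolynomial.monomial η (f.coeff η) =
        f.coeff η • MvPolynomial.monomial η (1 : F) := by simp [MvPolynomial.smul_monomial]
    have h3 := (hlt η hη).trans_le hle
    rw [h2, map_smul, map_smul, ih _ (by rw [← hk]; exact hlt η hη) η h3.le rfl, if_neg, smul_zero]
    intro h4
    rw [h4] at h3
    exact lt_irrefl _ h3
  rw [hf, map_sub, sub_eq_zero] at h0
  rw [h0, ← hb, Module.Basis.coord_apply, Module.Basis.repr_self, Finsupp.single_apply]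

/-- The special fibre can be read off from the Rees algebra: the coefficient of `T^w` after `t ↦ 0`
is the coefficient of `t^{l(w)}` in the coordinate at `w`. -/
theorem ker_reesMap_le_ker_specialMap (b : Module.Basis Γ F R)
    (hb : ∀ w, b w = MvPolynomial.aeval x (MvPolynomial.monomial (σ w) (1 : F)))
    (hred : ∀ α, ∃ f : MvPolynomial (Fin s) F, MvPolynomial.aeval x f =
        MvPolynomial.aeval x (MvPolynomial.monomial α (1 : F)) -
          MvPolynomial.aeval x (MvPolynomial.monomial (σ (monWeight γ α)) (1 : F)) ∧
        ∀ η ∈ f.support, l (monWeight γ η) < l (monWeight γ α)) :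
    RingHom.ker (reesMap F x fun i => l (γ i)) ≤ RingHom.ker (specialMap F γ) := by
  classical
  let coeffLin : ℤ → F[T;T⁻¹] →ₗ[F] F := fun k =>
    { toFun := fun f => f.coeff k
      map_add' := fun _ _ => rfl
      map_smul' := fun _ _ => rfl }
  let θ : Γ → F[T;T⁻¹] ⊗[F] R →ₗ[F] F := fun w =>
    (TensorProduct.lid F F).toLinearMap ∘ₗ TensorProduct.map (coeffLin (l w)) (b.coord w)
  have key : ∀ (w : Γ) (P : MvPolynomial (Fin s) (Polynomial F)),
      (specialMap F γ P : MvPolynomial (Fin r) F).coeff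
        (Finsupp.equivFunOnFinite.symm (w : Fin r → ℕ)) =
          θ w (reesMap F x (fun i => l (γ i)) P) := by
    intro w P
    induction P using MvPolynomial.induction_on' with
    | monomial α p =>
      rw [specialMap_apply, MvPolynomial.map_monomial, coe_toricMap_monomial,
        MvPolynomial.coeff_monomial, reesMap_monomial, weight_comp_eq]
      have hθ : ∀ f y, θ w (f ⊗ₜ y) = f.coeff (l w) * b.coord w y := fun f y => rfl
      rw [hθ]
      have hinj : Finsupp.equivFunOnFinite.symm (monWeight γ α : Fin r → ℕ) =
          Finsupp.equivFunOnFinite.symm (w : Fin r → ℕ) ↔ monWeight γ α = w := by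
        rw [Equiv.apply_eq_iff_eq, Subtype.ext_iff]
      simp only [hinj]
      induction p using Polynomial.induction_on' with
      | add p q hp hq =>
        have h1 : ∀ f g : F[T;T⁻¹], (f + g).coeff (l w : ℤ) =
          f.coeff (l w : ℤ) + g.coeff (l w : ℤ) := fun _ _ => rfl
        rw [map_add, map_add, add_mul, h1, add_mul, ← hp, ← hq]
        split_ifs <;> simp
      | monomial k a =>
        rw [← Polynomial.C_mul_X_pow_eq_monomial, Polynomial.toLaurent_C_mul_X_pow,
          LaurentPolynomial.mul_T_assoc, ← LaurentPolynomial.single_eq_C_mul_T,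
          AddMonoidAlgebra.coeff_single, Finsupp.single_apply]
        -- The exponent `k` of `t` is nonnegative, so the coordinate is needed only when `l
        -- (monWeight γ α) ≤ l w`; for weight exactly `w` only `k = 0` counts, as under `t ↦ 0`.
        by_cases hk : (k : ℤ) + l (monWeight γ α) = l w
        · rw [if_pos hk, coord_aeval_monomial b hb hred α w (by omega)]
          by_cases hw : monWeight γ α = w
          · have : k = 0 := by rw [hw] at hk; omega
            simp [hw, this]
          · simp [hw]
        · rw [if_neg hk, zero_mul]
          split_ifs with hw
          · have : k ≠ 0 := by rintro rfl; rw [hw] at hk; simp at hk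
            simp [this]
          · rfl
    | add p q hp hq => rw [map_add, map_add, AddMemClass.coe_add, MvPolynomial.coeff_add, hp, hq,
        map_add]
  intro P hP
  rw [RingHom.mem_ker] at hP ⊢
  refine Subtype.ext (MvPolynomial.ext _ _ fun u => ?_)
  by_cases hu : (u : Fin r → ℕ) ∈ Γ
  · have := key ⟨u, hu⟩ P
    rw [hP, map_zero] at this
    simpa using this
  · rw [specialMap_apply, (MvPolynomial.map (Polynomial.evalRingHom 0) P).as_sum, map_sum,
      AddSubmonoidClass.coe_finsetSum, MvPolynomial.coeff_sum]
    refine Finset.sum_eq_zero fun α _ => ?_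
    rw [coe_toricMap_monomial, MvPolynomial.coeff_monomial, if_neg]
    rintro rfl
    exact hu (by simp)

/-- Homogenizing the relation between a monomial and the chosen one of its weight puts positive
powers of `t` on all correction terms. Modulo `t` the binomials of the toric ideal are therefore
relations of the Rees algebra. -/
theorem ker_specialMap_le (hγ : AddSubmonoid.closure (Set.range γ) = ⊤)
    (hred : ∀ α, ∃ f : MvPolynomial (Fin s) F, MvPolynomial.aeval x f =
        MvPolynomial.aeval x (MvPolynomial.monomial α (1 : F)) -
          MvPolynomial.aeval x (MvPolynomial.monomial (σ (monWeight γ α)) (1 : F)) ∧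
        ∀ η ∈ f.support, l (monWeight γ η) < l (monWeight γ α))
    (hσ : ∀ w, monWeight γ (σ w) = w) :
    RingHom.ker (specialMap F γ) ≤ RingHom.ker (reesMap F x fun i => l (γ i)) ⊔
      Ideal.span {MvPolynomial.C Polynomial.X} := by
  set K := RingHom.ker (reesMap F x fun i => l (γ i)) ⊔ Ideal.span {MvPolynomial.C Polynomial.X}
  have hmon : ∀ α, MvPolynomial.monomial α (1 : Polynomial F) -
      MvPolynomial.monomial (σ (monWeight γ α)) 1 ∈ K := by
    intro α
    obtain ⟨f, hf, hlt⟩ := hred α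
    -- Homogenization of `f` to degree `l (monWeight γ α)`; the exponents of `t` are at least `1` by
    -- `hlt`.
    set H : MvPolynomial (Fin s) (Polynomial F) := ∑ η ∈ f.support, MvPolynomial.monomial η
      (Polynomial.monomial (l (monWeight γ α) - l (monWeight γ η)) (f.coeff η)) with hH
    have h1 : H ∈ Ideal.span {(MvPolynomial.C Polynomial.X :
        MvPolynomial (Fin s) (Polynomial F))} := by
      refine Ideal.sum_mem _ fun η hη => Ideal.mem_span_singleton.mpr
        ⟨MvPolynomial.monomial η
          (Polynomial.monomial (l (monWeight γ α) - l (monWeight γ η) - 1) (f.coeff η)), ?_⟩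
      rw [MvPolynomial.C_mul_monomial, Polynomial.X_mul_monomial, Nat.sub_add_cancel]
      have := hlt η hη
      omega
    have h2 : MvPolynomial.monomial α (1 : Polynomial F) -
        MvPolynomial.monomial (σ (monWeight γ α)) 1 - H ∈
          RingHom.ker (reesMap F x fun i => l (γ i)) := by
      have h3 : reesMap F x (fun i => l (γ i)) H =
          LaurentPolynomial.T (l (monWeight γ α) : ℤ) ⊗ₜ MvPolynomial.aeval x f := by
        conv_rhs => rw [f.as_sum, map_sum, TensorProduct.tmul_sum]
        rw [hH, map_sum]
        refine Finset.sum_congr rfl fun η hη => ?_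
        have h4 : MvPolynomial.monomial η (f.coeff η) =
            f.coeff η • MvPolynomial.monomial η (1 : F) := by simp [MvPolynomial.smul_monomial]
        rw [reesMap_monomial, weight_comp_eq, ← Polynomial.C_mul_X_pow_eq_monomial,
          Polynomial.toLaurent_C_mul_X_pow, LaurentPolynomial.mul_T_assoc, h4, map_smul,
          ← TensorProduct.smul_tmul, LaurentPolynomial.smul_eq_C_mul,
          Nat.cast_sub (hlt η hη).le, sub_add_cancel]
      rw [RingHom.mem_ker, map_sub, map_sub, h3, reesMap_monomial, reesMap_monomial,
        weight_comp_eq, weight_comp_eq, hσ, hf, TensorProduct.tmul_sub, Polynomial.toLaurent_one,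
        one_mul, sub_self]
    rw [← sub_add_cancel (MvPolynomial.monomial α (1 : Polynomial F) -
        MvPolynomial.monomial (σ (monWeight γ α)) 1) H]
    exact K.add_mem (Ideal.mem_sup_left h2) (Ideal.mem_sup_right h1)
  have htoric : (toricIdeal F γ).map (MvPolynomial.map Polynomial.C) ≤ K := by
    rw [toricIdeal, Ideal.map_span, Ideal.span_le]
    rintro _ ⟨_, ⟨α, β, hαβ, rfl⟩, rfl⟩
    have h1 := K.sub_mem (hmon α) (hmon β)
    rw [hαβ, sub_sub_sub_cancel_right] at h1
    simpa [MvPolynomial.map_monomial] using h1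
  intro P hP
  rw [RingHom.mem_ker, specialMap_apply, ← RingHom.mem_ker, ker_toricMap hγ] at hP
  rw [← sub_add_cancel P
    (MvPolynomial.map Polynomial.C (MvPolynomial.map (Polynomial.evalRingHom 0) P))]
  exact K.add_mem (Ideal.mem_sup_right (sub_map_C_map_eval_mem_span P))
    (htoric (Ideal.mem_map_of_mem _ hP))

theorem nonempty_algEquiv_of_eq_ker {A B : Type*} [CommRing A] [Algebra F A] [CommRing B]
    [Algebra F B] {e : A →ₐ[F] B} (he : Function.Surjective e) {I : Ideal A}
    (hI : I = RingHom.ker e) : Nonempty ((A ⧸ I) ≃ₐ[F] B) :=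
  ⟨(Ideal.quotientEquivAlgOfEq F hI).trans (Ideal.quotientKerAlgEquivOfSurjective he)⟩

theorem hasFlatDeformation_toricAlgebra (hγ : AddSubmonoid.closure (Set.range γ) = ⊤)
    (hσ : ∀ w, monWeight γ (σ w) = w)
    (hli : LinearIndependent F
      (fun w => MvPolynomial.aeval x (MvPolynomial.monomial (σ w) (1 : F))))
    (hx : Function.Surjective (MvPolynomial.aeval x : MvPolynomial (Fin s) F →ₐ[F] R))
    (hred : ∀ α, ∃ f : MvPolynomial (Fin s) F, MvPolynomial.aeval x f =
        MvPolynomial.aeval x (MvPolynomial.monomial α (1 : F)) -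
          MvPolynomial.aeval x (MvPolynomial.monomial (σ (monWeight γ α)) (1 : F)) ∧
        ∀ η ∈ f.support, l (monWeight γ η) < l (monWeight γ α)) :
    HasFlatDeformation F R (toricAlgebra F Γ) := by
  refine ⟨s, RingHom.ker (reesMap F x fun i => l (γ i)),
    flat_quotient_ker_reesMap x _, ?_, nonempty_algEquiv_laurent_quotient_ker_reesMap hx _⟩
  let b := Module.Basis.mk hli (span_range_aeval_monomial_eq_top hx hred).ge
  have hle := ker_reesMap_le_ker_specialMap b (fun w => Module.Basis.mk_apply _ _ w) hred
  set J := RingHom.ker (reesMap F x fun i => l (γ i))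
  let e : (MvPolynomial (Fin s) (Polynomial F) ⧸ J) →ₐ[F] toricAlgebra F Γ :=
    Ideal.Quotient.liftₐ J (specialMap F γ) hle
  have hmk : ∀ P, e (Ideal.Quotient.mk J P) = specialMap F γ P := fun P => rfl
  have he : Function.Surjective e := by
    intro y
    obtain ⟨P, rfl⟩ := specialMap_surjective hγ y
    exact ⟨Ideal.Quotient.mk J P, hmk P⟩
  have hker : Ideal.span {algebraMap (Polynomial F) (MvPolynomial (Fin s) (Polynomial F) ⧸ J)
      Polynomial.X} = RingHom.ker e := by
    have halg : algebraMap (Polynomial F) (MvPolynomial (Fin s) (Polynomial F) ⧸ J) Polynomial.X =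
        Ideal.Quotient.mk J (MvPolynomial.C Polynomial.X) := rfl
    refine le_antisymm ?_ ?_
    · rw [Ideal.span_singleton_le_iff_mem, halg, RingHom.mem_ker, hmk, specialMap_apply]
      simp
    · intro y hy
      obtain ⟨P, rfl⟩ := Ideal.Quotient.mk_surjective y
      rw [RingHom.mem_ker, hmk] at hy
      have h1 := Ideal.mem_map_of_mem (Ideal.Quotient.mk J) (ker_specialMap_le hγ hred hσ hy)
      rw [Ideal.map_sup, Ideal.map_quotient_self, bot_sup_eq, Ideal.map_span,
        Set.image_singleton] at h1
      exact h1
  exact nonempty_algEquiv_of_eq_ker he hker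

end Deformation

/-! ### The main theorem -/

theorem mainTheorem1 {F : Type*} [Field F] [Finite F] {r : ℕ} (Γ : AddSubmonoid (Fin r → ℕ))
    (hfg : Γ.FG) [LinearOrder Γ] (hΓ : IsWellOrderedSemigroup Γ) :
    -- every order domain with value semigroup `Γ` has a flat deformation to `R_Γ`
    (∀ (R : Type*) [CommRing R] [Algebra F R] (ρ : R → WithBot Γ), IsOrderFunction F ρ →
      HasFlatDeformation F R (toricAlgebra F Γ)) ∧
    -- for generators `γ₁, …, γ_s` of `Γ` (the columns of `M`)
    ∀ (s : ℕ) (γ : Fin s → Γ), AddSubmonoid.closure (Set.range γ) = ⊤ →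
      -- `F[X₁, …, X_s] / I_Γ ≅ R_Γ`, with `X_i` going to `T^{γ_i}`
      (∃ e : (MvPolynomial (Fin s) F ⧸ toricIdeal F γ) ≃ₐ[F] toricAlgebra F Γ,
        ∀ i, (e (Ideal.Quotient.mk _ (MvPolynomial.X i)) : MvPolynomial (Fin r) F) =
          toricMonomial F (γ i : Fin r → ℕ)) ∧
      ∀ τ : MonomialOrder (Fin s),
        -- the order domains with value semigroup `Γ` have presentations of Gröbner basis form
        (∀ (R : Type*) [CommRing R] [Algebra F R] (ρ : R → WithBot Γ), IsOrderFunction F ρ →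
          ∃ I : Ideal (MvPolynomial (Fin s) F), IsGeilPellikaanForm hΓ γ τ I ∧
            Nonempty (R ≃ₐ[F] (MvPolynomial (Fin s) F ⧸ I))) ∧
        -- conversely, the algebras of this form are order domains with value semigroup `Γ`
        (∀ I : Ideal (MvPolynomial (Fin s) F), IsGeilPellikaanForm hΓ γ τ I →
          ∃ ρ : MvPolynomial (Fin s) F ⧸ I → WithBot Γ,
            IsOrderFunction F ρ ∧ IsMaxWeight hΓ γ τ I ρ) := by
  refine ⟨fun R _ _ ρ hρ => ?_, fun s γ hγ => ⟨?_, fun τ => ⟨fun R _ _ ρ hρ => ?_, fun I hI =>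
    hI.exists_isOrderFunction hγ⟩⟩⟩
  · obtain ⟨t, ht⟩ := (AddMonoid.fg_iff_addSubmonoid_fg Γ).mpr hfg |>.fg_top
    -- The deformation is built from any finite generating set; here an enumeration of `t`.
    let γ : Fin t.card → Γ := fun i => t.equivFin.symm i
    have hγ : AddSubmonoid.closure (Set.range γ) = ⊤ := by
      have : Set.range γ = t := by
        change Set.range (Subtype.val ∘ t.equivFin.symm) = _
        rw [EquivLike.range_comp, Subtype.range_coe_subtype]
        rfl
      rw [this, ht]
    obtain ⟨x, l, σ, hσ, hli, hx, hred⟩ :=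
      hρ.exists_natWeight hΓ Γ.subtype Γ.subtype_injective hγ
    exact hasFlatDeformation_toricAlgebra hγ hσ hli hx hred
  · refine ⟨(Ideal.quotientEquivAlgOfEq F (ker_toricMap hγ).symm).trans
      (Ideal.quotientKerAlgEquivOfSurjective (toricMap_surjective hγ)), fun i => ?_⟩
    change (toricMap F γ (MvPolynomial.X i) : MvPolynomial (Fin r) F) = _
    rw [toricMap, MvPolynomial.aeval_X]
  · choose x hx using fun i => hρ.surjective (γ i)
    refine ⟨_, hρ.isGeilPellikaanForm_ker hΓ hγ hx τ,
      ⟨(Ideal.quotientKerAlgEquivOfSurjective fun y => ?_).symm⟩⟩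
    obtain ⟨f, hf, -⟩ := hρ.exists_aeval_eq hΓ hγ hx y
    exact ⟨f, hf⟩
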